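/- Let $m>0$, $\mu_p<m$, $\lambda\in\mathbb R$ and $n\ge 0$ an integer. For momenta $k=(p,p_\perp)$, $p>0$, put $\omega(k)=\frac{m^2+p^2+p_\perp^2}{2p}$ and $d\kappa(k)=\frac{dp\,dp_\perp}{(2\pi)^2\,2p}$. Let $\mathcal F^{(n)}$ be the Hilbert space of symmetric functions in $L^2$ of $n$ momenta with respect to $\kappa^{\otimes n}$ (with $\mathcal F^{(0)}=\mathbb C$), and let $H_0$ be multiplication by $\sum_i\omega(k_i)$. For $\operatorname{Re}E<nm+\mu_p$ define on $\mathcal F^{(n)}$ $$K(E)=(H_0-E+\mu_p)+\lambda^2\int\Big(\frac1{\omega(k)-\mu_p}-\frac1{H_0-E+\omega(k)}\Big)d\kappa(k),$$ $$(U(E)\psi)(k_1,\dots,k_n)=\lambda^2\sum_{i=1}^n\int\frac{\psi(k_1,\dots,k_{i-1},k,k_{i+1},\dots,k_n)}{\sum_j\omega(k_j)-E+\omega(k)}\,d\kappa(k),$$ each on its maximal domain; $U(E)$ is the $n$-boson form of $\lambda^2\iint\frac{dp\,dp_\perp}{(2\pi)^2}\frac{dq\,dq_\perp}{(2\pi)^2}\frac{1}{2\sqrt{pq}}\,a^\dagger(q,q_\perp)\frac1{H_0-E+\omega(p,p_\perp)+\omega(q,q_\perp)}a(p,p_\perp)$.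 The principal operator is $\Phi(E)=K(E)-U(E)$ (on the intersection of the domains). 1. For every real $E<m(n-1)+\mu_p$ with $$\frac{\lambda^2\pi n}{2\,(m(n-1)+\mu_p-E)}<1,$$ the operator $K(E)^{-1/2}U(E)K(E)^{-1/2}$ is everywhere defined and bounded on $\mathcal F^{(n)}$ with $\|K(E)^{-1/2}U(E)K(E)^{-1/2}\|<1$, and $\Phi(E)$ is a bijection of its domain onto $\mathcal F^{(n)}$ with bounded inverse. 2. Let $(\phi^{(+)}f)(k_1,\dots,k_n)=\sqrt{n+1}\int f(k,k_1,\dots,k_n)\,d\kappa(k)$ and $(\phi^{(-)}g)(k_1,\dots,k_{n+1})=\frac1{\sqrt{n+1}}\sum_i g(k_1,\dots,\widehat{k_i},\dots,k_{n+1})$, and write $a=H_0-E$ on $\mathcal F^{(n+1)}$, $b=\lambda\phi^{(+)}$, $b^\dagger=\lambda\phi^{(-)}$ (only the products $ba^{-1}$ and $a^{-1}b^\dagger$, which are bounded, are used). There is exactly one self-adjoint operator $H$ on $\mathcal F^{(n+1)}\oplus\mathcal F^{(n)}$ (the Hamiltonian of the model in this sector) such that, for every $E\in\mathbb C$ with $\operatorname{Re}E<nm+\mu_p$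 at which $\Phi(E)$ has a bounded inverse, $E$ is in the resolvent set of $H$ and $$(H-E)^{-1}=\begin{pmatrix}a^{-1}+a^{-1}b^\dagger\Phi(E)^{-1}ba^{-1}&-a^{-1}b^\dagger\Phi(E)^{-1}\\-\Phi(E)^{-1}ba^{-1}&\Phi(E)^{-1}\end{pmatrix}.$$ Its spectrum is nonempty and bounded below, and the ground state energy $E_{gr}=\inf\sigma(H)$ satisfies $$E_{gr}\ \ge\ m(n-1)+\mu_p-\frac{\lambda^2\pi n}{2}.$$ -/

import Mathlib

open MeasureTheory

noncomputable section

namespace LightFrontLee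

/-! ### Momentum space and the bosonic Fock sectors -/

/-- The invariant measure `dp dp⊥ / ((2π)² 2p)` on momenta `k = (p, p⊥)` with `p > 0`. -/
def momentumMeasure : Measure (ℝ × ℝ) :=
  (volume.restrict {k : ℝ × ℝ | 0 < k.1}).withDensity
    fun k => ENNReal.ofReal (1 / ((2 * Real.pi) ^ 2 * (2 * k.1)))

instance : SigmaFinite momentumMeasure := by
  unfold momentumMeasure; infer_instance

/-- The product measure `∏ᵢ dpᵢ dpᵢ⊥ / ((2π)² 2pᵢ)` on `n`-particle momenta. -/
def nMeasure (n : ℕ) : Measure (Fin n → ℝ × ℝ) :=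
  Measure.pi fun _ => momentumMeasure

instance (n : ℕ) : SigmaFinite (nMeasure n) := by
  unfold nMeasure; infer_instance

theorem measurePreserving_insertNth (n : ℕ) (i : Fin (n + 1)) :
    MeasurePreserving (fun q : (ℝ × ℝ) × (Fin n → ℝ × ℝ) =>
      (i.insertNth q.1 q.2 : Fin (n + 1) → ℝ × ℝ))
      (momentumMeasure.prod (nMeasure n)) (nMeasure (n + 1)) :=
  (measurePreserving_piFinSuccAbove (fun _ : Fin (n + 1) => momentumMeasure) i).symm

theorem measurePreserving_perm (n : ℕ) (σ : Equiv.Perm (Fin n)) :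
    MeasurePreserving (fun k : Fin n → ℝ × ℝ => k ∘ σ) (nMeasure n) (nMeasure n) := by
  exact measurePreserving_arrowCongr' (fun _ : Fin n => momentumMeasure)
    (fun _ : Fin n => momentumMeasure) σ.symm (MeasurableEquiv.refl (ℝ × ℝ))
    (fun _ => MeasurePreserving.id _)

/-- For a.e. `k`, an a.e. property holds at `(p, k)` for a.e. `p`. -/
theorem ae_cons {n : ℕ} {P : (Fin (n + 1) → ℝ × ℝ) → Prop} (h : ∀ᵐ k ∂nMeasure (n + 1), P k) :
    ∀ᵐ k ∂nMeasure n, ∀ᵐ p ∂momentumMeasure, P (Fin.cons p k) := by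
  have h1 := (measurePreserving_insertNth n 0).quasiMeasurePreserving.ae h
  have h2 := (Measure.measurePreserving_swap
    (μ := nMeasure n) (ν := momentumMeasure)).quasiMeasurePreserving.ae h1
  filter_upwards [Measure.ae_ae_of_ae_prod h2] with k hk
  simpa [Fin.insertNth_zero'] using hk

/-- Forgetting one momentum is compatible with a.e. statements. -/
theorem ae_removeNth {n : ℕ} (i : Fin (n + 1)) {P : (Fin n → ℝ × ℝ) → Prop}
    (h : ∀ᵐ k ∂nMeasure n, P k) : ∀ᵐ k ∂nMeasure (n + 1), P (i.removeNth k) := by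
  have h1 : ∀ᵐ q ∂(momentumMeasure.prod (nMeasure n)), P q.2 :=
    Measure.quasiMeasurePreserving_snd.ae h
  have h2 := (measurePreserving_piFinSuccAbove
    (fun _ : Fin (n + 1) => momentumMeasure) i).quasiMeasurePreserving.ae h1
  exact h2

/-- For a.e. `k`, an a.e. property still holds when one momentum is replaced by a.e. `p`. -/
theorem ae_update {n : ℕ} (i : Fin n) {P : (Fin n → ℝ × ℝ) → Prop}
    (h : ∀ᵐ k ∂nMeasure n, P k) :
    ∀ᵐ k ∂nMeasure n, ∀ᵐ p ∂momentumMeasure, P (Function.update k i p) := by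
  cases n with
  | zero => exact i.elim0
  | succ n =>
    have h1 := (measurePreserving_insertNth n i).quasiMeasurePreserving.ae h
    have h2 := (Measure.measurePreserving_swap
      (μ := nMeasure n) (ν := momentumMeasure)).quasiMeasurePreserving.ae h1
    filter_upwards [ae_removeNth i (Measure.ae_ae_of_ae_prod h2)] with k hk
    filter_upwards [hk] with p hp
    simpa [Fin.insertNth_removeNth] using hp

/-- The symmetric square integrable functions of `n` momenta, with the invariant norm
`∫ |ψ|² ∏ᵢ dpᵢ dpᵢ⊥ / ((2π)² 2pᵢ)`. -/
def symmetricSubspace (n : ℕ) : Submodule ℂ (Lp ℂ 2 (nMeasure n)) where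
  carrier := {ψ | ∀ σ : Equiv.Perm (Fin n), (fun k => ψ (k ∘ σ)) =ᵐ[nMeasure n] ψ}
  add_mem' {ψ χ} hψ hχ σ := by
    have h1 := Lp.coeFn_add ψ χ
    have h2 := (measurePreserving_perm n σ).quasiMeasurePreserving.ae h1
    filter_upwards [h1, h2, hψ σ, hχ σ] with k a b c d
    simp only [Pi.add_apply] at a b
    rw [a, b, c, d]
  zero_mem' σ := by
    have h1 := Lp.coeFn_zero ℂ 2 (nMeasure n)
    have h2 := (measurePreserving_perm n σ).quasiMeasurePreserving.ae h1
    filter_upwards [h1, h2] with k a b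
    rw [a, b]; rfl
  smul_mem' c ψ hψ σ := by
    have h1 := Lp.coeFn_smul c ψ
    have h2 := (measurePreserving_perm n σ).quasiMeasurePreserving.ae h1
    filter_upwards [h1, h2, hψ σ] with k a b d
    simp only [Pi.smul_apply] at a b
    rw [a, b, d]

/-- The `n`-boson sector of the Fock space. -/
abbrev Fock (n : ℕ) : Type := symmetricSubspace n

theorem isClosed_symmetricSubspace (n : ℕ) :
    IsClosed (symmetricSubspace n : Set (Lp ℂ 2 (nMeasure n))) := by
  have : (symmetricSubspace n : Set (Lp ℂ 2 (nMeasure n))) =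
      ⋂ σ : Equiv.Perm (Fin n),
        {ψ | Lp.compMeasurePreserving _ (measurePreserving_perm n σ) ψ = ψ} := by
    ext ψ
    simp only [Set.mem_iInter, Set.mem_ofPred_eq]
    refine forall_congr' fun σ => ?_
    have h := Lp.coeFn_compMeasurePreserving ψ (measurePreserving_perm n σ)
    constructor
    · intro hψ
      exact Lp.ext (h.trans hψ)
    · intro hψ
      rw [hψ] at h
      exact h.symm
  rw [this]
  exact isClosed_iInter fun σ => isClosed_eq
    (Lp.isometry_compMeasurePreserving (measurePreserving_perm n σ)).continuous continuous_id

instance (n : ℕ) : CompleteSpace (Fock n) :=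
  (isClosed_symmetricSubspace n).completeSpace_coe

/-- The value of a state at the momenta `k` (a representative, determined almost everywhere). -/
def amp {n : ℕ} (ψ : Fock n) : (Fin n → ℝ × ℝ) → ℂ := (ψ : Lp ℂ 2 (nMeasure n))

theorem amp_zero (n : ℕ) : amp (0 : Fock n) =ᵐ[nMeasure n] 0 :=
  Lp.coeFn_zero ℂ 2 (nMeasure n)

theorem amp_add {n : ℕ} (ψ χ : Fock n) : amp (ψ + χ) =ᵐ[nMeasure n] amp ψ + amp χ :=
  Lp.coeFn_add (ψ : Lp ℂ 2 (nMeasure n)) χ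

theorem amp_smul {n : ℕ} (c : ℂ) (ψ : Fock n) : amp (c • ψ) =ᵐ[nMeasure n] c • amp ψ :=
  Lp.coeFn_smul c (ψ : Lp ℂ 2 (nMeasure n))

theorem amp_ext {n : ℕ} {ψ χ : Fock n} (h : amp ψ =ᵐ[nMeasure n] amp χ) : ψ = χ :=
  Subtype.ext (Lp.ext h)

/-! ### Unbounded operators -/

section PartialOperators

variable {V W X : Type*} [AddCommGroup V] [Module ℂ V] [AddCommGroup W] [Module ℂ W]
  [AddCommGroup X] [Module ℂ X]

/-- Composition `B ∘ A` of unbounded operators on its natural domain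
`{x ∈ D(A) | A x ∈ D(B)}`. -/
def pcomp (B : W →ₗ.[ℂ] X) (A : V →ₗ.[ℂ] W) : V →ₗ.[ℂ] X :=
  Submodule.toLinearPMap
    { carrier := {z | ∃ y, (z.1, y) ∈ A.graph ∧ (y, z.2) ∈ B.graph}
      add_mem' := by
        rintro z z' ⟨y, h1, h2⟩ ⟨y', h1', h2'⟩
        exact ⟨y + y', A.graph.add_mem h1 h1', B.graph.add_mem h2 h2'⟩
      zero_mem' := ⟨0, A.graph.zero_mem, B.graph.zero_mem⟩
      smul_mem' := by
        rintro c z ⟨y, h1, h2⟩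
        exact ⟨c • y, A.graph.smul_mem c h1, B.graph.smul_mem c h2⟩ }

theorem mem_graph_pcomp (B : W →ₗ.[ℂ] X) (A : V →ₗ.[ℂ] W) (x : V) (z : X) :
    (x, z) ∈ (pcomp B A).graph ↔ ∃ y, (x, y) ∈ A.graph ∧ (y, z) ∈ B.graph := by
  rw [pcomp, Submodule.toLinearPMap_graph_eq]
  · rfl
  · rintro ⟨x, z⟩ ⟨y, h1, h2⟩ h0
    simp only at h0 h1 h2
    subst h0
    have : y = 0 := LinearPMap.graph_fst_eq_zero_snd A h1 rfl
    subst this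
    exact LinearPMap.graph_fst_eq_zero_snd B h2 rfl

/-- `A - E` on the domain of `A`. -/
def shift (A : V →ₗ.[ℂ] V) (E : ℂ) : V →ₗ.[ℂ] V :=
  A - (E • (LinearMap.id : V →ₗ[ℂ] V)).toPMap ⊤

end PartialOperators

section BoundedInverse

variable {V : Type*} [NormedAddCommGroup V] [NormedSpace ℂ V]

/-- `A` maps its domain bijectively onto the whole space, and the bounded operator `T` is the
inverse. -/
def HasBoundedInverse (A : V →ₗ.[ℂ] V) (T : V →L[ℂ] V) : Prop :=
  ∀ x y : V, (x, y) ∈ A.graph ↔ T y = x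

/-- The real points of the spectrum of `A`. -/
def realSpectrum (A : V →ₗ.[ℂ] V) : Set ℝ :=
  {E | ¬ ∃ R : V →L[ℂ] V, HasBoundedInverse (shift A (E : ℂ)) R}

/-- The ground state energy of a self-adjoint operator: the bottom of its spectrum. -/
def groundStateEnergy (A : V →ₗ.[ℂ] V) : ℝ := sInf (realSpectrum A)

end BoundedInverse

/-! ### The operators of the model

Throughout, `m` is the boson mass, `mu` the physical energy `μ_p` of the down state, and `lam` the
coupling constant. -/

/-- The dispersion relation `ω(p, p⊥) = (m² + p² + p⊥²) / (2p)`. -/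
def omega (m : ℝ) (k : ℝ × ℝ) : ℝ := (m ^ 2 + k.1 ^ 2 + k.2 ^ 2) / (2 * k.1)

/-- The free energy: `H₀` is multiplication by `∑ᵢ ω(kᵢ)`. -/
def freeEnergy (m : ℝ) {n : ℕ} (k : Fin n → ℝ × ℝ) : ℝ := ∑ i, omega m (k i)

/-- The function `s(H₀)` of the free Hamiltonian: multiplication by `s (∑ᵢ ω(kᵢ))` on its
maximal domain. -/
def funH0 (m : ℝ) (n : ℕ) (s : ℝ → ℂ) : Fock n →ₗ.[ℂ] Fock n :=
  Submodule.toLinearPMap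
    { carrier := {z | amp z.2 =ᵐ[nMeasure n] fun k => s (freeEnergy m k) * amp z.1 k}
      add_mem' := by
        intro z z' h h'
        filter_upwards [h, h', amp_add z.1 z'.1, amp_add z.2 z'.2] with k a b c d
        simp only [Prod.fst_add, Prod.snd_add]
        rw [d, c, Pi.add_apply, Pi.add_apply, a, b, mul_add]
      zero_mem' := by
        filter_upwards [amp_zero n] with k a
        simp only [Prod.fst_zero, Prod.snd_zero]
        rw [a]; simp
      smul_mem' := by
        intro c z h
        filter_upwards [h, amp_smul c z.1, amp_smul c z.2] with k a b d
        simp only [Prod.smul_fst, Prod.smul_snd]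
        rw [d, b, Pi.smul_apply, Pi.smul_apply, a, smul_eq_mul, smul_eq_mul]; ring }

theorem mem_graph_funH0 (m : ℝ) (n : ℕ) (s : ℝ → ℂ) (ψ χ : Fock n) :
    (ψ, χ) ∈ (funH0 m n s).graph ↔
      amp χ =ᵐ[nMeasure n] fun k => s (freeEnergy m k) * amp ψ k := by
  rw [funH0, Submodule.toLinearPMap_graph_eq]
  · rfl
  · rintro ⟨x, z⟩ h h0
    simp only at h0
    subst h0
    refine amp_ext ?_
    filter_upwards [(h : amp z =ᵐ[nMeasure n] _), amp_zero n] with k a b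
    rw [a, b]; simp

/-- The function `h ↦ (h - E + μ_p) + λ² ∫ (dp dp⊥ / (2π)²) (1/2p) (1/(ω - μ_p) - 1/(h - E + ω))`. -/
def kineticSymbol (m mu lam : ℝ) (E : ℂ) (h : ℝ) : ℂ :=
  ((h : ℂ) - E + mu) + (lam : ℂ) ^ 2 *
    ∫ k, (1 / ((omega m k : ℂ) - mu) - 1 / ((h : ℂ) - E + omega m k)) ∂momentumMeasure

/-- The kinetic part `K(E) = (H₀ - E + μ_p) + K₁(E)`. -/
def kineticOp (m mu lam : ℝ) (n : ℕ) (E : ℂ) : Fock n →ₗ.[ℂ] Fock n :=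
  funH0 m n (kineticSymbol m mu lam E)

/-- `K(E)^{-1/2}`. -/
def kineticInvSqrt (m mu lam : ℝ) (n : ℕ) (E : ℂ) : Fock n →ₗ.[ℂ] Fock n :=
  funH0 m n fun h => kineticSymbol m mu lam E h ^ (-(1 / 2) : ℂ)

/-- The integrand of the potential in the source momentum `p`, for the `i`-th boson. -/
def potentialIntegrand (m : ℝ) {n : ℕ} (E : ℂ) (ψ : Fock n) (k : Fin n → ℝ × ℝ) (i : Fin n)
    (p : ℝ × ℝ) : ℂ :=
  amp ψ (Function.update k i p) / ((freeEnergy m k : ℂ) - E + omega m p)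

/-- The potential
`U(E) = λ² ∫∫ (dp dp⊥ / (2π)²) (dq dq⊥ / (2π)²) (1 / (2√(pq)))
  a†(q, q⊥) (H₀ - E + ω(p, p⊥) + ω(q, q⊥))⁻¹ a(p, p⊥)`
in the `n`-boson sector, on its maximal domain. It replaces in turn each momentum `kᵢ`
(the created `q`) by the annihilated `p`; the operator `H₀` in the middle acts on the other `n - 1`
bosons, so that the denominator is `∑ⱼ ω(kⱼ) - E + ω(p)`. The factors `1 / √(2p)`, `1 / √(2q)` are
absorbed by the invariant normalization of the wave functions. -/
def potentialOp (m lam : ℝ) (n : ℕ) (E : ℂ) : Fock n →ₗ.[ℂ] Fock n :=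
  Submodule.toLinearPMap
    { carrier := {z |
        (∀ᵐ k ∂nMeasure n, ∀ i, Integrable (potentialIntegrand m E z.1 k i) momentumMeasure) ∧
        amp z.2 =ᵐ[nMeasure n] fun k =>
          (lam : ℂ) ^ 2 * ∑ i, ∫ p, potentialIntegrand m E z.1 k i p ∂momentumMeasure}
      add_mem' := by
        rintro z z' ⟨h1, h2⟩ ⟨h1', h2'⟩
        have key : ∀ᵐ k ∂nMeasure n, ∀ i, potentialIntegrand m E (z + z').1 k i
            =ᵐ[momentumMeasure]
            potentialIntegrand m E z.1 k i + potentialIntegrand m E z'.1 k i := by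
          refine ae_all_iff.2 fun i => ?_
          filter_upwards [ae_update i (amp_add z.1 z'.1)] with k hk
          filter_upwards [hk] with p hp
          simp only [potentialIntegrand, Prod.fst_add, Pi.add_apply]
          rw [hp, Pi.add_apply, add_div]
        constructor
        · filter_upwards [h1, h1', key] with k a b c i
          exact ((a i).add (b i)).congr (c i).symm
        · filter_upwards [h1, h1', key, h2, h2', amp_add z.2 z'.2] with k a b c d e f
          simp only [Prod.snd_add]
          rw [f, Pi.add_apply, d, e, ← mul_add, ← Finset.sum_add_distrib]
          congr 1
          refine Finset.sum_congr rfl fun i _ => ?_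
          rw [integral_congr_ae (c i), ← integral_add (a i) (b i)]
          rfl
      zero_mem' := by
        have key : ∀ᵐ k ∂nMeasure n, ∀ i,
            potentialIntegrand m E (0 : Fock n × Fock n).1 k i =ᵐ[momentumMeasure] 0 := by
          refine ae_all_iff.2 fun i => ?_
          filter_upwards [ae_update i (amp_zero n)] with k hk
          filter_upwards [hk] with p hp
          simp only [potentialIntegrand, Prod.fst_zero]
          rw [hp]; simp
        constructor
        · filter_upwards [key] with k c i
          exact (integrable_zero _ _ _).congr (c i).symm
        · filter_upwards [key, amp_zero n] with k c d
          simp only [Prod.snd_zero]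
          rw [d, Finset.sum_eq_zero fun i _ => by rw [integral_congr_ae (c i)]; simp]
          simp
      smul_mem' := by
        rintro c z ⟨h1, h2⟩
        have key : ∀ᵐ k ∂nMeasure n, ∀ i, potentialIntegrand m E (c • z).1 k i
            =ᵐ[momentumMeasure] c • potentialIntegrand m E z.1 k i := by
          refine ae_all_iff.2 fun i => ?_
          filter_upwards [ae_update i (amp_smul c z.1)] with k hk
          filter_upwards [hk] with p hp
          simp only [potentialIntegrand, Prod.smul_fst, Pi.smul_apply]
          rw [hp, Pi.smul_apply, smul_eq_mul, smul_eq_mul, mul_div_assoc]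
        constructor
        · filter_upwards [h1, key] with k a b i
          exact ((a i).smul c).congr (b i).symm
        · filter_upwards [h1, key, h2, amp_smul c z.2] with k a b d e
          simp only [Prod.smul_snd]
          rw [e, Pi.smul_apply, d, smul_eq_mul, mul_left_comm, Finset.mul_sum]
          congr 1
          refine Finset.sum_congr rfl fun i _ => ?_
          rw [integral_congr_ae (b i), ← smul_eq_mul, ← integral_smul]
          rfl }

theorem mem_graph_potentialOp (m lam : ℝ) (n : ℕ) (E : ℂ) (ψ χ : Fock n) :
    (ψ, χ) ∈ (potentialOp m lam n E).graph ↔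
      (∀ᵐ k ∂nMeasure n, ∀ i, Integrable (potentialIntegrand m E ψ k i) momentumMeasure) ∧
      amp χ =ᵐ[nMeasure n] fun k =>
        (lam : ℂ) ^ 2 * ∑ i, ∫ p, potentialIntegrand m E ψ k i p ∂momentumMeasure := by
  rw [potentialOp, Submodule.toLinearPMap_graph_eq]
  · rfl
  · rintro ⟨x, z⟩ ⟨-, h⟩ h0
    simp only at h0 h
    subst h0
    refine amp_ext ?_
    have key : ∀ᵐ k ∂nMeasure n, ∀ i,
        potentialIntegrand m E (0 : Fock n) k i =ᵐ[momentumMeasure] 0 := by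
      refine ae_all_iff.2 fun i => ?_
      filter_upwards [ae_update i (amp_zero n)] with k hk
      filter_upwards [hk] with p hp
      simp only [potentialIntegrand]
      rw [hp]; simp
    filter_upwards [h, key, amp_zero n] with k a c d
    rw [a, d, Finset.sum_eq_zero fun i _ => by rw [integral_congr_ae (c i)]; simp]
    simp

/-- `K(E)^{-1/2} U(E) K(E)^{-1/2}` on its natural domain. -/
def relativePotential (m mu lam : ℝ) (n : ℕ) (E : ℂ) : Fock n →ₗ.[ℂ] Fock n :=
  pcomp (kineticInvSqrt m mu lam n E)
    (pcomp (potentialOp m lam n E) (kineticInvSqrt m mu lam n E))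

/-- The renormalized principal operator `Φ(E) = K(E) - U(E)`. -/
def principalOp (m mu lam : ℝ) (n : ℕ) (E : ℂ) : Fock n →ₗ.[ℂ] Fock n :=
  kineticOp m mu lam n E - potentialOp m lam n E

/-! ### The resolvent formula and the Hamiltonian

With `a = H₀ - E` on `n + 1` bosons and `b = λ φ⁽⁺⁾(0)`, where
`(φ⁽⁺⁾(0) f)(k) = √(n+1) ∫ f(p, k) dp dp⊥ / ((2π)² 2p)` and
`(φ⁽⁻⁾(0) g)(k) = (n+1)^{-1/2} ∑ᵢ g(k without kᵢ)`. -/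

/-- `b a⁻¹ = λ φ⁽⁺⁾(0) (H₀ - E)⁻¹`, from `n + 1` to `n` bosons. -/
def IsBAInv (m lam : ℝ) (n : ℕ) (E : ℂ) (f : Fock (n + 1)) (w : Fock n) : Prop :=
  (∀ᵐ k ∂nMeasure n, Integrable (fun p : ℝ × ℝ =>
      amp f (Fin.cons p k) / ((freeEnergy m (Fin.cons p k : Fin (n + 1) → ℝ × ℝ) : ℂ) - E))
      momentumMeasure) ∧
  amp w =ᵐ[nMeasure n] fun k => (lam : ℂ) * ((Real.sqrt (n + 1) : ℝ) : ℂ) * ∫ p : ℝ × ℝ,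
      amp f (Fin.cons p k) / ((freeEnergy m (Fin.cons p k : Fin (n + 1) → ℝ × ℝ) : ℂ) - E)
      ∂momentumMeasure

/-- `a⁻¹ b† = (H₀ - E)⁻¹ λ φ⁽⁻⁾(0)`, from `n` to `n + 1` bosons. -/
def IsAInvBdag (m lam : ℝ) (n : ℕ) (E : ℂ) (g : Fock n) (u : Fock (n + 1)) : Prop :=
  amp u =ᵐ[nMeasure (n + 1)] fun k =>
    ((freeEnergy m k : ℂ) - E)⁻¹ *
      ((lam : ℂ) * (((Real.sqrt (n + 1))⁻¹ : ℝ) : ℂ) *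
        ∑ i : Fin (n + 1), amp g (i.removeNth k))

/-- The Hilbert space of the sector: `n + 1` bosons with the up state, and `n` bosons with the
down state. -/
abbrev Sector (n : ℕ) : Type := WithLp 2 (Fock (n + 1) × Fock n)

/-- `R` is the bounded operator with the block form `[α γ; β δ]`, where
`α = a⁻¹ + a⁻¹ b† Φ⁻¹ b a⁻¹`, `β = -Φ⁻¹ b a⁻¹`, `γ = -a⁻¹ b† Φ⁻¹`, `δ = Φ⁻¹`, and `Φinv = Φ(E)⁻¹`. -/
def IsBlockResolvent (m lam : ℝ) (n : ℕ) (E : ℂ) (Φinv : Fock n →L[ℂ] Fock n)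
    (R : Sector n →L[ℂ] Sector n) : Prop :=
  ∀ (f : Fock (n + 1)) (g : Fock n),
    ∃ (af : Fock (n + 1)) (bf : Fock n) (cf cg : Fock (n + 1)),
      (f, af) ∈ (funH0 m (n + 1) fun h => ((h : ℂ) - E)⁻¹).graph ∧
      IsBAInv m lam n E f bf ∧
      IsAInvBdag m lam n E (Φinv bf) cf ∧
      IsAInvBdag m lam n E (Φinv g) cg ∧
      R (WithLp.toLp 2 (f, g)) = WithLp.toLp 2 (af + cf - cg, -Φinv bf + Φinv g)

/-- `H` is the Hamiltonian of the model in the sector with `n` or `n + 1` bosons: the self-adjoint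
operator whose resolvent `(H - E)⁻¹` is given by the block formula at every `E` with
`Re E < n m + μ_p` at which `Φ(E)` has a bounded inverse. -/
structure IsHamiltonian (m mu lam : ℝ) (n : ℕ) (H : Sector n →ₗ.[ℂ] Sector n) : Prop where
  selfAdjoint : IsSelfAdjoint H
  resolvent : ∀ E : ℂ, E.re < n * m + mu → ∀ Φinv : Fock n →L[ℂ] Fock n,
    HasBoundedInverse (principalOp m mu lam n E) Φinv →
      ∃ R : Sector n →L[ℂ] Sector n,
        IsBlockResolvent m lam n E Φinv R ∧ HasBoundedInverse (shift H E) R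

end LightFrontLee

end

noncomputable section

namespace LightFrontLee

/-! ### Abstract operator theory -/

/-! Everything rests on one integral. In the variable t = p⊥/p the weight of κ cancels, dκ = dp
dt/(8π²), and ω = m²/(2p) + (1 + t²)p/2, whence ∫ (ω + c)⁻² dκ ≤ 1/(4πc) for c > 0
(`lintegral_inv_omega_add_sq_le`). So (z + ω)⁻¹ lies in L²(κ) for Re z > -m, which controls K(E),
U(E), ba⁻¹ and a⁻¹b†.

Part 1. Put c = m(n-1) + μ_p - E > 0. The integral in K(E) is nonnegative, so K(E) ≥ H₀ - E + μ_p.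
U(E) is a sum of n integral operators, each acting on one momentum. Let x and y be the target and
source momenta, X = ω(x) + c and Y = ω(y) + c. As ω ≥ m > μ_p, the denominator of U is at least (X +
Y)/2 ≥ √(XY), and the factors K^{-1/2} contribute at most (XY)^{-1/2}. The kernel of each term of
K^{-1/2}UK^{-1/2} is thus at most λ²/(XY), and its Hilbert–Schmidt norm at most λ²/(4πc), uniformly
in the other momenta (`isHSKernel_relative`). The sum has norm at most nλ²/(4πc), less than 1 under
the stated condition. A Neumann series then gives Φ⁻¹ = K^{-1/2}(1 - K^{-1/2}UK^{-1/2})⁻¹K^{-1/2}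
(`exists_principal_inverse`).

Part 2. At a low real energy E₀ the block matrix R₀ is bounded, symmetric and injective, so H = E₀ +
R₀⁻¹ is self-adjoint; one resolvent determines H, which gives uniqueness. At any other admissible E
the block matrix is the resolvent of H because it satisfies the resolvent identity with R₀
(`blockOperator_resolvent_identity`). This reduces to Φ(E) = Φ(F) - (E - F)(1 + b a(E)⁻¹ a(F)⁻¹ b†)
(`mem_graph_principalOp_of_mem`): in the last product, annihilating the boson just created accounts
for the change of K, and annihilating another one for the change of U. The spectrum of H is nonempty
because R₀, self-adjoint and nonzero, has a nonzero spectral point z, giving E₀ + 1/z in the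
spectrum of H. It is bounded below because Part 1 inverts Φ(E) at every real E below the asserted
bound. -/

theorem mem_graph_shift {V : Type*} [AddCommGroup V] [Module ℂ V] (A : V →ₗ.[ℂ] V) (E : ℂ)
    (x y : V) : (x, y) ∈ (shift A E).graph ↔ (x, y + E • x) ∈ A.graph := by
  simp only [LinearPMap.mem_graph_iff, shift]
  constructor
  · rintro ⟨z, rfl, h⟩
    refine ⟨⟨z.1, z.2.1⟩, rfl, ?_⟩
    rw [← h, LinearPMap.sub_apply]
    simp
  · rintro ⟨z, rfl, h⟩
    refine ⟨⟨z.1, z.2, trivial⟩, rfl, ?_⟩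
    rw [LinearPMap.sub_apply]
    simp [h]

theorem mem_graph_sub {V : Type*} [AddCommGroup V] [Module ℂ V] (A B : V →ₗ.[ℂ] V)
    (x y : V) : (x, y) ∈ (A - B).graph ↔
      ∃ u v, (x, u) ∈ A.graph ∧ (x, v) ∈ B.graph ∧ y = u - v := by
  simp only [LinearPMap.mem_graph_iff]
  constructor
  · rintro ⟨z, rfl, h⟩
    refine ⟨_, _, ⟨⟨z.1, z.2.1⟩, rfl, rfl⟩, ⟨⟨z.1, z.2.2⟩, rfl, rfl⟩, ?_⟩
    rw [← h, LinearPMap.sub_apply]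
  · rintro ⟨u, v, ⟨a, rfl, ha⟩, ⟨b, hb, hb'⟩, rfl⟩
    have hab : b = ⟨a.1, hb ▸ b.2⟩ := Subtype.ext hb
    refine ⟨⟨a.1, a.2, hb ▸ b.2⟩, rfl, ?_⟩
    rw [← ha, ← hb', congrArg B hab]
    exact LinearPMap.sub_apply _ _ _

/-- A linear relation defined everywhere and satisfying a norm bound is the graph of a bounded
operator. -/
theorem exists_clm_of_rel {V W : Type*} [NormedAddCommGroup V] [NormedSpace ℂ V]
    [NormedAddCommGroup W] [NormedSpace ℂ W] (P : V → W → Prop) (C : ℝ) (hC : 0 ≤ C)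
    (hadd : ∀ x y x' y', P x y → P x' y' → P (x + x') (y + y'))
    (hsmul : ∀ (c : ℂ) x y, P x y → P (c • x) (c • y))
    (hex : ∀ x, ∃ y, P x y) (hbd : ∀ x y, P x y → ‖y‖ ≤ C * ‖x‖) :
    ∃ T : V →L[ℂ] W, ‖T‖ ≤ C ∧ ∀ x y, P x y ↔ T x = y := by
  -- The norm bound at the difference of two pairs, whose first entry is 0, makes the relation
  -- single-valued.
  have huniq : ∀ x y y', P x y → P x y' → y = y' := by
    intro x y y' h h'
    have h1 := hbd _ _ (hadd _ _ _ _ h (hsmul (-1) _ _ h'))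
    have h2 : ‖y - y'‖ ≤ 0 := by simpa [sub_eq_add_neg] using h1
    exact sub_eq_zero.1 (norm_le_zero_iff.1 h2)
  choose f hf using hex
  let L : V →ₗ[ℂ] W :=
    { toFun := f
      map_add' := fun x y => huniq _ _ _ (hf _) (hadd _ _ _ _ (hf x) (hf y))
      map_smul' := fun c x => huniq _ _ _ (hf _) (hsmul c _ _ (hf x)) }
  refine ⟨L.mkContinuous C fun x => hbd _ _ (hf x), L.mkContinuous_norm_le hC _, fun x y => ?_⟩
  constructor
  · exact fun h => huniq _ _ _ (hf x) h
  · rintro rfl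
    exact hf x

/-! ### Resolvents, self-adjointness and spectrum -/

section Resolvent

variable {V : Type*} [NormedAddCommGroup V] [InnerProductSpace ℂ V]

theorem HasBoundedInverse.shift_iff {H : V →ₗ.[ℂ] V} {E : ℂ} {R : V →L[ℂ] V}
    (h : HasBoundedInverse (shift H E) R) (x y : V) :
    (x, y) ∈ H.graph ↔ R (y - E • x) = x := by
  rw [← h, mem_graph_shift, sub_add_cancel]

/-- The operator `H` with `(H - E)⁻¹ = R`. -/
def ofResolvent (R : V →L[ℂ] V) (E : ℂ) : V →ₗ.[ℂ] V :=
  Submodule.toLinearPMap (LinearMap.ker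
    ((R : V →ₗ[ℂ] V) ∘ₗ (LinearMap.snd ℂ V V - E • LinearMap.fst ℂ V V) - LinearMap.fst ℂ V V))

theorem mem_graph_ofResolvent {R : V →L[ℂ] V} (hR : Function.Injective R) (E : ℂ) (x y : V) :
    (x, y) ∈ (ofResolvent R E).graph ↔ R (y - E • x) = x := by
  rw [ofResolvent, Submodule.toLinearPMap_graph_eq]
  · simp [LinearMap.mem_ker, sub_eq_zero]
  · rintro ⟨x, z⟩ h h0
    simp only at h0
    subst h0
    simp only [LinearMap.mem_ker, LinearMap.sub_apply, LinearMap.comp_apply, LinearMap.snd_apply,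
      LinearMap.smul_apply, LinearMap.fst_apply, smul_zero, sub_zero] at h
    exact hR (by simpa using h)

theorem hasBoundedInverse_ofResolvent {R : V →L[ℂ] V} (hR : Function.Injective R) (E : ℂ) :
    HasBoundedInverse (shift (ofResolvent R E) E) R := by
  intro x y
  rw [mem_graph_shift, mem_graph_ofResolvent hR, add_sub_cancel_right]

theorem eq_of_resolvent {H H' : V →ₗ.[ℂ] V} {E : ℂ} {R : V →L[ℂ] V}
    (h : HasBoundedInverse (shift H E) R) (h' : HasBoundedInverse (shift H' E) R) : H = H' := by
  refine LinearPMap.eq_of_eq_graph ?_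
  ext ⟨x, y⟩
  rw [h.shift_iff, h'.shift_iff]

/-- The domain is the range of the injective symmetric `R`, hence dense. Since the graph is
parametrized by (R c, c + E R c), the adjoint relation tested on it reads R(y - E x) = x, which is
the graph again; `E` has to be real for this. -/
theorem isSelfAdjoint_ofResolvent [CompleteSpace V] {R : V →L[ℂ] V} (hR : Function.Injective R)
    (hsa : ∀ x y, inner ℂ (R x) y = inner ℂ x (R y)) (E : ℝ) :
    IsSelfAdjoint (ofResolvent R E) := by
  have hdom : ∀ x, R x ∈ (ofResolvent R E).domain := by
    intro x
    have : (R x, x + (E : ℂ) • R x) ∈ (ofResolvent R E).graph := by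
      rw [mem_graph_ofResolvent hR, add_sub_cancel_right]
    exact LinearPMap.mem_domain_of_mem_graph this
  have hdense : Dense ((ofResolvent R E).domain : Set V) := by
    rw [Submodule.dense_iff_topologicalClosure_eq_top, Submodule.topologicalClosure_eq_top_iff,
      Submodule.eq_bot_iff]
    intro y hy
    -- Testing `y` against R(R y) turns orthogonality to the range into ‖R y‖² = 0.
    have h1 := (Submodule.mem_orthogonal _ _).1 hy (R (R y)) (hdom _)
    rw [hsa] at h1
    have h2 : R y = 0 := inner_self_eq_zero.1 h1
    exact hR (by simpa using h2)
  rw [LinearPMap.isSelfAdjoint_def]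
  refine LinearPMap.eq_of_eq_graph ?_
  rw [LinearPMap.adjoint_graph_eq_graph_adjoint hdense]
  ext ⟨x, y⟩
  rw [Submodule.mem_adjoint_iff, mem_graph_ofResolvent hR]
  constructor
  · intro h
    refine ext_inner_left ℂ fun c => ?_
    have h1 := h (R c) (c + (E : ℂ) • R c)
      (by rw [mem_graph_ofResolvent hR, add_sub_cancel_right])
    simp only [inner_add_left, inner_smul_left, hsa, Complex.conj_ofReal] at h1
    simp only [map_sub, map_smul, inner_sub_right, inner_smul_right]
    linear_combination -h1
  · intro h a b hab
    rw [mem_graph_ofResolvent hR] at hab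
    have h1 : inner ℂ (b - (E : ℂ) • a) x = inner ℂ a (y - (E : ℂ) • x) := by
      conv_lhs => rw [← h]
      rw [← hsa, hab]
    simp only [inner_sub_left, inner_sub_right, inner_smul_left, inner_smul_right,
      Complex.conj_ofReal] at h1
    linear_combination h1

/-- The resolvent identity turns a resolvent at one point into a resolvent at another. -/
theorem hasBoundedInverse_of_resolvent_identity {H : V →ₗ.[ℂ] V} {E F : ℂ} {R Q : V →L[ℂ] V}
    (h : HasBoundedInverse (shift H F) R)
    (h1 : ∀ x, Q x - R x = (E - F) • Q (R x)) (h2 : ∀ x, Q x - R x = (E - F) • R (Q x)) :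
    HasBoundedInverse (shift H E) Q := by
  intro x y
  rw [mem_graph_shift, h.shift_iff]
  have e : y + E • x - F • x = y + (E - F) • x := by rw [sub_smul]; abel
  rw [e, map_add, map_smul]
  -- `Q` and `R` are not known to commute: `h1` gives the forward direction and `h2` the converse.
  constructor
  · intro hx
    have h3 := h1 (y + (E - F) • x)
    rw [map_add R, map_smul R, hx, map_add, map_smul] at h3
    rw [← sub_eq_zero]
    rw [← sub_eq_zero] at h3
    rw [← h3]
    abel
  · intro hx
    have h3 := h2 y
    rw [hx] at h3
    rw [← h3]; abel

/-- A bounded self-adjoint operator attains its norm as spectral radius, so `R` has a nonzero real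
spectral point z. If H - E - 1/z had a bounded inverse `Q`, then z - R would be invertible. -/
theorem realSpectrum_nonempty [CompleteSpace V] [Nontrivial V] {H : V →ₗ.[ℂ] V} {E : ℝ}
    {R : V →L[ℂ] V} (hR : Function.Injective R)
    (hsa : ∀ x y, inner ℂ (R x) y = inner ℂ x (R y))
    (h : HasBoundedInverse (shift H (E : ℂ)) R) : (realSpectrum H).Nonempty := by
  by_contra hne
  have hall : ∀ F : ℝ, ∃ Q : V →L[ℂ] V, HasBoundedInverse (shift H (F : ℂ)) Q := by
    intro F
    by_contra hF
    exact hne ⟨F, hF⟩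
  have hsa' : IsSelfAdjoint R := by
    rw [ContinuousLinearMap.isSelfAdjoint_iff_isSymmetric]
    exact hsa
  have hR0 : R ≠ 0 := by
    rintro rfl
    obtain ⟨x, hx⟩ := exists_ne (0 : V)
    exact hx (hR (by simp))
  obtain ⟨z, hz, hz'⟩ := spectrum.exists_nnnorm_eq_spectralRadius R
  rw [hsa'.spectralRadius_eq_nnnorm] at hz'
  have hz0 : z ≠ 0 := by
    rintro rfl
    have : ‖R‖₊ = 0 := by simpa using hz'.symm
    exact hR0 (nnnorm_eq_zero.1 this)
  have hzr : z = (z.re : ℂ) := hsa'.mem_spectrum_eq_re hz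
  have hr0 : z.re ≠ 0 := by
    intro h0
    rw [hzr, h0] at hz0
    simp at hz0
  obtain ⟨Q, hQ⟩ := hall (E + (z.re)⁻¹)
  refine hz ?_
  rw [spectrum.mem_resolventSet_iff]
  have hQH : ∀ y, R (y + z⁻¹ • Q y) = Q y := by
    intro y
    have h1 := (hQ (Q y) y).2 rfl
    rw [mem_graph_shift, h.shift_iff] at h1
    rw [← h1]
    congr 1
    rw [h1, hzr]
    push_cast
    simp only [Complex.ofReal_re]
    rw [add_smul]
    abel
  have hHQ : ∀ y, Q (y - z⁻¹ • R y) = R y := by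
    intro y
    have h1 := (h (R y) y).2 rfl
    rw [mem_graph_shift, hQ.shift_iff] at h1
    rw [← h1]
    congr 1
    rw [h1]
    nth_rewrite 1 [hzr]
    push_cast
    rw [add_smul]
    abel
  -- From z - R = z (H - E - 1/z) R, the inverse is z⁻¹ (H - E) Q = z⁻¹ (1 + z⁻¹ Q).
  refine isUnit_iff_exists.2 ⟨z⁻¹ • (1 + z⁻¹ • Q), ?_, ?_⟩
  · ext y
    have := hQH y
    simp only [map_add, map_smul] at this
    have h1 : R (Q y) = z • (Q y - R y) := by
      rw [← eq_sub_iff_add_eq'] at this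
      rw [← this, smul_smul, mul_inv_cancel₀ hz0, one_smul]
    simp only [mul_apply_eq_comp, sub_apply, smul_apply, add_apply, map_smul, map_add,
      one_apply_eq_self, Algebra.algebraMap_eq_smul_one, h1]
    match_scalars <;> field_simp <;> ring
  · ext y
    have := hHQ y
    simp only [map_sub, map_smul] at this
    have h1 : Q (R y) = z • (Q y - R y) := by
      rw [sub_eq_iff_eq_add, ← sub_eq_iff_eq_add'] at this
      rw [this, smul_smul, mul_inv_cancel₀ hz0, one_smul]
    simp only [mul_apply_eq_comp, sub_apply, smul_apply, add_apply, map_smul, map_sub,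
      one_apply_eq_self, Algebra.algebraMap_eq_smul_one, h1]
    match_scalars <;> field_simp <;> ring

end Resolvent

/-! ### The momentum measure -/

theorem measurable_omega (m : ℝ) : Measurable (omega m) := by
  unfold omega; fun_prop

theorem ae_momentum_pos : ∀ᵐ p ∂momentumMeasure, 0 < p.1 := by
  have : ∀ᵐ p ∂(volume.restrict {k : ℝ × ℝ | 0 < k.1}), 0 < p.1 :=
    ae_restrict_mem (measurableSet_lt measurable_const measurable_fst)
  exact (withDensity_absolutelyContinuous _ _).ae_le this

theorem le_omega {m : ℝ} {p : ℝ × ℝ} (hp : 0 < p.1) : m ≤ omega m p := by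
  rw [omega, le_div_iff₀ (by positivity)]
  nlinarith [sq_nonneg (m - p.1), sq_nonneg p.2]

theorem ae_le_omega (m : ℝ) : ∀ᵐ p ∂momentumMeasure, m ≤ omega m p :=
  ae_momentum_pos.mono fun _ hp => le_omega hp

/-- The substitution p⊥ = p t has Jacobian p, which cancels the p in the weight 1/((2π)² 2p) and
leaves the constant 1/(8π²). -/
theorem lintegral_momentumMeasure {f : ℝ × ℝ → ENNReal} (hf : Measurable f) :
    ∫⁻ p, f p ∂momentumMeasure = ∫⁻ t : ℝ, ∫⁻ p in Set.Ioi (0 : ℝ),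
      ENNReal.ofReal (1 / (8 * Real.pi ^ 2)) * f (p, p * t) := by
  have hset : MeasurableSet {k : ℝ × ℝ | 0 < k.1} :=
    measurableSet_lt (measurable_const (a := (0 : ℝ))) measurable_fst
  have hd : Measurable fun k : ℝ × ℝ =>
      ENNReal.ofReal (1 / ((2 * Real.pi) ^ 2 * (2 * k.1))) := by fun_prop
  rw [momentumMeasure, lintegral_withDensity_eq_lintegral_mul _ hd hf]
  have hs : {k : ℝ × ℝ | 0 < k.1} = Set.Ioi (0 : ℝ) ×ˢ Set.univ := by
    ext; simp
  rw [hs, Measure.volume_eq_prod, ← Measure.prod_restrict, Measure.restrict_univ,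
    lintegral_prod _ (hd.mul hf).aemeasurable,
    lintegral_lintegral_swap (μ := volume) (ν := volume.restrict (Set.Ioi (0 : ℝ)))]
  swap
  · refine Measurable.aemeasurable ?_
    fun_prop
  · refine setLIntegral_congr_fun measurableSet_Ioi fun p hp => ?_
    have hp' : (0 : ℝ) < p := hp
    have hg : Measurable fun t : ℝ => f (p, t) := by fun_prop
    simp only [Pi.mul_apply]
    rw [lintegral_const_mul _ hg, lintegral_const_mul _ (by fun_prop)]
    have h1 : ∫⁻ q, f (p, q) = ENNReal.ofReal p * ∫⁻ t, f (p, p * t) := by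
      have h2 := Real.smul_map_volume_mul_left hp'.ne'
      rw [abs_of_pos hp'] at h2
      conv_lhs => rw [← h2]
      rw [lintegral_smul_measure, lintegral_map hg (by fun_prop), smul_eq_mul]
    rw [h1, ← mul_assoc, ← ENNReal.ofReal_mul (by positivity)]
    congr 2
    field_simp
    norm_num

theorem lintegral_Ioi_inv_sq {a c : ℝ} (ha : 0 < a) (hc : 0 < c) :
    ∫⁻ p in Set.Ioi (0 : ℝ), ENNReal.ofReal (((c + a * p) ^ 2)⁻¹) = ENNReal.ofReal ((a * c)⁻¹) := by
  have hderiv : ∀ p ∈ Set.Ici (0 : ℝ),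
      HasDerivAt (fun p => -(a * (c + a * p))⁻¹) (((c + a * p) ^ 2)⁻¹) p := by
    intro p hp
    have hp' : (0 : ℝ) ≤ p := hp
    have hpos : 0 < c + a * p := by positivity
    have h1 : HasDerivAt (fun p => a * (c + a * p)) (a * (a * 1)) p :=
      (((hasDerivAt_id p).const_mul a).const_add c).const_mul a
    refine (h1.inv (by positivity)).neg.congr_deriv ?_
    field_simp
  have hlim : Filter.Tendsto (fun p => -(a * (c + a * p))⁻¹) Filter.atTop (nhds 0) := by
    rw [← neg_zero]
    refine (Filter.Tendsto.inv_tendsto_atTop ?_).neg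
    refine Filter.Tendsto.const_mul_atTop ha ?_
    exact Filter.tendsto_atTop_add_const_left _ _ (Filter.tendsto_id.const_mul_atTop ha)
  have hpos : ∀ p ∈ Set.Ioi (0 : ℝ), 0 ≤ ((c + a * p) ^ 2)⁻¹ := fun p _ => by positivity
  have hint := integrableOn_Ioi_deriv_of_nonneg' hderiv hpos hlim
  have hval := integral_Ioi_of_hasDerivAt_of_tendsto' hderiv hint hlim
  rw [← ofReal_integral_eq_lintegral_ofReal hint
    ((ae_restrict_iff' measurableSet_Ioi).2 (ae_of_all _ hpos)), hval]
  simp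

/-- The elementary bound `∫ (ω + c)⁻² dκ ≤ 1 / (4 π c)`. -/
theorem lintegral_inv_omega_add_sq_le (m : ℝ) {c : ℝ} (hc : 0 < c) :
    ∫⁻ p, ENNReal.ofReal (((omega m p + c) ^ 2)⁻¹) ∂momentumMeasure ≤
      ENNReal.ofReal (1 / (4 * Real.pi * c)) := by
  have hm := measurable_omega m
  rw [lintegral_momentumMeasure (by fun_prop)]
  calc
    -- The mass term m²/(2p) of ω is dropped. The p-integral is then elementary, and the remaining ∫
    -- dt/(1 + t²) = π gives the constant.
    _ ≤ ∫⁻ t : ℝ, ∫⁻ p in Set.Ioi (0 : ℝ), ENNReal.ofReal (1 / (8 * Real.pi ^ 2)) *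
          ENNReal.ofReal (((c + (1 + t ^ 2) / 2 * p) ^ 2)⁻¹) := by
        refine lintegral_mono fun t => setLIntegral_mono' measurableSet_Ioi fun p hp => ?_
        have hp' : (0 : ℝ) < p := hp
        have : omega m (p, p * t) = m ^ 2 / (2 * p) + (1 + t ^ 2) / 2 * p := by
          simp only [omega]
          field_simp
          ring
        have h2 : 0 ≤ m ^ 2 / (2 * p) := by positivity
        have h3 : c + (1 + t ^ 2) / 2 * p ≤ omega m (p, p * t) + c := by linarith
        have h4 : 0 < c + (1 + t ^ 2) / 2 * p := by positivity
        gcongr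
    _ = ∫⁻ t : ℝ, ENNReal.ofReal (1 / (4 * Real.pi ^ 2 * c)) *
          ENNReal.ofReal ((1 + t ^ 2)⁻¹) := by
        refine lintegral_congr fun t => ?_
        rw [lintegral_const_mul _ (by fun_prop), lintegral_Ioi_inv_sq (by positivity) hc,
          ← ENNReal.ofReal_mul (by positivity), ← ENNReal.ofReal_mul (by positivity)]
        congr 1
        field_simp
        norm_num
    _ = ENNReal.ofReal (1 / (4 * Real.pi * c)) := by
        rw [lintegral_const_mul _ (by fun_prop), ← ofReal_integral_eq_lintegral_ofReal
          integrable_inv_one_add_sq (ae_of_all _ fun t => by positivity),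
          integral_univ_inv_one_add_sq, ← ENNReal.ofReal_mul (by positivity)]
        congr 1
        field_simp

/-- Uniform square integrability of `(z + ω)⁻¹` for `Re z` bounded away from `-m`. -/
theorem exists_lintegral_inv_sq_le {m d : ℝ} (hm : 0 < m) (hd : 0 < d) :
    ∃ C : NNReal, ∀ z : ℂ, d - m ≤ z.re →
      ∫⁻ p, ‖(z + omega m p)⁻¹‖ₑ ^ 2 ∂momentumMeasure ≤ C := by
  -- With t = min(1, d/m), Re z + ω ≥ (ω - m) + d ≥ tω ≥ (t/2)(ω + m), so the integral with c = m
  -- dominates.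
  obtain ⟨t, ht0, ht1, htd⟩ : ∃ t : ℝ, 0 < t ∧ t ≤ 1 ∧ t * m ≤ d :=
    ⟨min 1 (d / m), by positivity, min_le_left _ _, by
      calc min 1 (d / m) * m ≤ d / m * m := by gcongr; exact min_le_right _ _
        _ = d := by field_simp⟩
  refine ⟨(ENNReal.ofReal ((4 / t ^ 2) * (1 / (4 * Real.pi * m)))).toNNReal, fun z hz => ?_⟩
  rw [ENNReal.coe_toNNReal ENNReal.ofReal_ne_top, ENNReal.ofReal_mul (by positivity)]
  refine le_trans ?_ (mul_le_mul_right (lintegral_inv_omega_add_sq_le m hm) _)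
  have hmeas := measurable_omega m
  rw [← lintegral_const_mul _ (by fun_prop)]
  refine lintegral_mono_ae ?_
  filter_upwards [ae_le_omega m] with p hp
  rw [← ENNReal.ofReal_mul (by positivity), ← ofReal_norm,
    ← ENNReal.ofReal_pow (norm_nonneg _)]
  refine ENNReal.ofReal_le_ofReal ?_
  have h1 : t / 2 * (omega m p + m) ≤ ‖z + omega m p‖ := by
    refine le_trans ?_ (Complex.re_le_norm _)
    simp only [Complex.add_re, Complex.ofReal_re]
    nlinarith
  have h0 : 0 < omega m p + m := by linarith
  rw [norm_inv, inv_pow]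
  calc (‖z + omega m p‖ ^ 2)⁻¹ ≤ ((t / 2 * (omega m p + m)) ^ 2)⁻¹ := by gcongr
    _ = _ := by field_simp; norm_num

theorem memLp_inv_add_omega {m : ℝ} (hm : 0 < m) {z : ℂ} (hz : -m < z.re) :
    MemLp (fun p => (z + omega m p)⁻¹) 2 momentumMeasure := by
  obtain ⟨C, hC⟩ := exists_lintegral_inv_sq_le hm (d := z.re + m) (by linarith)
  have hmeas := measurable_omega m
  refine ⟨Measurable.aestronglyMeasurable (by fun_prop), ?_⟩
  rw [eLpNorm_lt_top_iff_lintegral_rpow_enorm_lt_top (by simp) (by simp)]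
  refine lt_of_le_of_lt ?_ (ENNReal.coe_lt_top (r := C))
  simpa using hC z (by linarith)

theorem integrable_inv_mul_inv {m : ℝ} (hm : 0 < m) {z w : ℂ} (hz : -m < z.re) (hw : -m < w.re) :
    Integrable (fun p => (z + omega m p)⁻¹ * (w + omega m p)⁻¹) momentumMeasure :=
  (memLp_inv_add_omega hm hz).integrable_mul (memLp_inv_add_omega hm hw)

/-! ### States, slices and kernels -/

theorem measurable_freeEnergy (m : ℝ) (n : ℕ) :
    Measurable (freeEnergy m : (Fin n → ℝ × ℝ) → ℝ) := by
  unfold freeEnergy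
  exact Finset.measurable_sum _ fun i _ => (measurable_omega m).comp (measurable_pi_apply i)

theorem ae_momenta_pos (n : ℕ) : ∀ᵐ k ∂nMeasure n, ∀ i, 0 < (k i).1 :=
  ae_all_iff.2 fun i =>
    (Measure.quasiMeasurePreserving_eval (μ := fun _ : Fin n => momentumMeasure) i).ae
      ae_momentum_pos

theorem le_freeEnergy (m : ℝ) {n : ℕ} {k : Fin n → ℝ × ℝ} (hk : ∀ i, 0 < (k i).1) :
    n * m ≤ freeEnergy m k := by
  have := Finset.card_nsmul_le_sum Finset.univ (fun i => omega m (k i)) m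
    fun i _ => le_omega (hk i)
  simpa [freeEnergy] using this

theorem ae_le_freeEnergy (m : ℝ) (n : ℕ) : ∀ᵐ k ∂nMeasure n, n * m ≤ freeEnergy m k :=
  (ae_momenta_pos n).mono fun _ => le_freeEnergy m

theorem freeEnergy_insertNth (m : ℝ) {n : ℕ} (i : Fin (n + 1)) (p : ℝ × ℝ)
    (r : Fin n → ℝ × ℝ) :
    freeEnergy m (i.insertNth p r : Fin (n + 1) → ℝ × ℝ) = omega m p + freeEnergy m r := by
  simp [freeEnergy, Fin.sum_univ_succAbove _ i]

theorem freeEnergy_cons (m : ℝ) {n : ℕ} (p : ℝ × ℝ) (r : Fin n → ℝ × ℝ) :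
    freeEnergy m (Fin.cons p r : Fin (n + 1) → ℝ × ℝ) = omega m p + freeEnergy m r := by
  rw [← Fin.insertNth_zero', freeEnergy_insertNth]

theorem freeEnergy_comp_perm (m : ℝ) {n : ℕ} (k : Fin n → ℝ × ℝ) (σ : Equiv.Perm (Fin n)) :
    freeEnergy m (k ∘ σ) = freeEnergy m k :=
  Equiv.sum_comp σ fun i => omega m (k i)

theorem measurable_insertNth {n : ℕ} (i : Fin (n + 1)) :
    Measurable fun q : (ℝ × ℝ) × (Fin n → ℝ × ℝ) =>
      (i.insertNth q.1 q.2 : Fin (n + 1) → ℝ × ℝ) :=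
  (measurePreserving_insertNth n i).measurable

theorem lintegral_insertNth {n : ℕ} (i : Fin (n + 1)) {f : (Fin (n + 1) → ℝ × ℝ) → ENNReal}
    (hf : Measurable f) :
    ∫⁻ k, f k ∂nMeasure (n + 1) =
      ∫⁻ r, ∫⁻ p, f (i.insertNth p r) ∂momentumMeasure ∂nMeasure n := by
  rw [← (measurePreserving_insertNth n i).lintegral_comp hf]
  exact lintegral_prod_symm' _ (hf.comp (measurable_insertNth i))

theorem ae_insertNth {n : ℕ} (i : Fin (n + 1)) {P : (Fin (n + 1) → ℝ × ℝ) → Prop}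
    (h : ∀ᵐ k ∂nMeasure (n + 1), P k) :
    ∀ᵐ r ∂nMeasure n, ∀ᵐ p ∂momentumMeasure, P (i.insertNth p r) := by
  have h1 := (measurePreserving_insertNth n i).quasiMeasurePreserving.ae h
  have h2 := (Measure.measurePreserving_swap
    (μ := nMeasure n) (ν := momentumMeasure)).quasiMeasurePreserving.ae h1
  exact Measure.ae_ae_of_ae_prod h2

theorem integral_insertNth {n : ℕ} (i : Fin (n + 1)) {f : (Fin (n + 1) → ℝ × ℝ) → ℂ}
    (hf : Integrable f (nMeasure (n + 1))) :
    ∫ k, f k ∂nMeasure (n + 1) =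
      ∫ r, ∫ p, f (i.insertNth p r) ∂momentumMeasure ∂nMeasure n := by
  have hmp := measurePreserving_insertNth n i
  have hint := hmp.integrable_comp_of_integrable hf
  refine Eq.trans ?_ (integral_prod_symm _ hint)
  rw [← hmp.map_eq] at hf ⊢
  exact integral_map hmp.measurable.aemeasurable hf.aestronglyMeasurable

/-! ### Square integrability, norms and inner products of states -/

theorem measurable_amp {n : ℕ} (ψ : Fock n) : Measurable (amp ψ) :=
  (Lp.stronglyMeasurable _).measurable

theorem memLp_amp {n : ℕ} (ψ : Fock n) : MemLp (amp ψ) 2 (nMeasure n) :=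
  Lp.memLp _

theorem ae_amp_comp_perm {n : ℕ} (ψ : Fock n) (σ : Equiv.Perm (Fin n)) :
    ∀ᵐ k ∂nMeasure n, amp ψ (k ∘ σ) = amp ψ k :=
  ψ.2 σ

theorem eLpNorm_two_sq {α : Type*} [MeasurableSpace α] (μ : Measure α) (f : α → ℂ) :
    eLpNorm f 2 μ ^ 2 = ∫⁻ a, ‖f a‖ₑ ^ 2 ∂μ := by
  have := eLpNorm_nnreal_pow_eq_lintegral (μ := μ) (f := f) (p := 2) (by norm_num)
  simpa using this

theorem memLp_two_of_lintegral_lt_top {α : Type*} [MeasurableSpace α] {μ : Measure α}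
    {f : α → ℂ} (hf : AEStronglyMeasurable f μ) (h : ∫⁻ a, ‖f a‖ₑ ^ 2 ∂μ < ⊤) : MemLp f 2 μ := by
  refine ⟨hf, ?_⟩
  rw [← eLpNorm_two_sq] at h
  by_contra h'
  simp only [not_lt, top_le_iff] at h'
  simp [h'] at h

theorem MemLp.lintegral_sq_lt_top {α : Type*} [MeasurableSpace α] {μ : Measure α} {f : α → ℂ}
    (hf : MemLp f 2 μ) : ∫⁻ a, ‖f a‖ₑ ^ 2 ∂μ < ⊤ := by
  rw [← eLpNorm_two_sq]
  exact ENNReal.pow_lt_top hf.2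

theorem enorm_sq_eq_lintegral {n : ℕ} (ψ : Fock n) :
    ‖ψ‖ₑ ^ 2 = ∫⁻ k, ‖amp ψ k‖ₑ ^ 2 ∂nMeasure n := by
  rw [← eLpNorm_two_sq, amp, ← Lp.enorm_def]
  rfl

theorem exists_amp_eq {n : ℕ} {f : (Fin n → ℝ × ℝ) → ℂ} (hf : MemLp f 2 (nMeasure n))
    (hsym : ∀ σ : Equiv.Perm (Fin n), ∀ᵐ k ∂nMeasure n, f (k ∘ σ) = f k) :
    ∃ χ : Fock n, amp χ =ᵐ[nMeasure n] f := by
  refine ⟨⟨hf.toLp f, fun σ => ?_⟩, hf.coeFn_toLp⟩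
  have h := hf.coeFn_toLp
  have h2 := (measurePreserving_perm n σ).quasiMeasurePreserving.ae h
  filter_upwards [h, h2, hsym σ] with k a b c
  rw [a, b, c]

theorem norm_le_of_lintegral_le {n n' : ℕ} {ψ : Fock n} {χ : Fock n'}
    {f : (Fin n' → ℝ × ℝ) → ℂ} {C : NNReal} (h : amp χ =ᵐ[nMeasure n'] f)
    (hf : ∫⁻ k, ‖f k‖ₑ ^ 2 ∂nMeasure n' ≤ C ^ 2 * ∫⁻ k, ‖amp ψ k‖ₑ ^ 2 ∂nMeasure n) :
    ‖χ‖ ≤ C * ‖ψ‖ := by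
  have h1 : ‖χ‖ₑ ^ 2 ≤ (C * ‖ψ‖ₑ) ^ 2 := by
    rw [mul_pow, enorm_sq_eq_lintegral, enorm_sq_eq_lintegral]
    refine le_trans (le_of_eq (lintegral_congr_ae ?_)) hf
    filter_upwards [h] with k hk
    rw [hk]
  have h2 : ‖χ‖ₑ ≤ C * ‖ψ‖ₑ := (ENNReal.pow_le_pow_left_iff two_ne_zero).1 h1
  have h3 : ‖χ‖₊ ≤ C * ‖ψ‖₊ := by
    simpa only [enorm_eq_nnnorm, ← ENNReal.coe_mul, ENNReal.coe_le_coe] using h2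
  exact_mod_cast h3

theorem inner_eq_integral {n : ℕ} (φ ψ : Fock n) :
    inner ℂ φ ψ = ∫ k, amp ψ k * (starRingEnd ℂ) (amp φ k) ∂nMeasure n := by
  change inner ℂ (φ : Lp ℂ 2 (nMeasure n)) (ψ : Lp ℂ 2 (nMeasure n)) = _
  rw [L2.inner_def]
  rfl

theorem integrable_mul_conj {α : Type*} [MeasurableSpace α] {μ : Measure α} {f g : α → ℂ}
    (hf : MemLp f 2 μ) (hg : MemLp g 2 μ) :
    Integrable (fun a => f a * (starRingEnd ℂ) (g a)) μ :=
  hf.integrable_mul hg.star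

theorem ae_memLp_insertNth {n : ℕ} (i : Fin (n + 1)) {f : (Fin (n + 1) → ℝ × ℝ) → ℂ}
    (hfm : Measurable f) (hf : MemLp f 2 (nMeasure (n + 1))) :
    ∀ᵐ r ∂nMeasure n, MemLp (fun p => f (i.insertNth p r)) 2 momentumMeasure := by
  have h := MemLp.lintegral_sq_lt_top hf
  have hm : Measurable fun k => ‖f k‖ₑ ^ 2 := by fun_prop
  rw [lintegral_insertNth i hm] at h
  have hm2 : Measurable fun q : (Fin n → ℝ × ℝ) × (ℝ × ℝ) => ‖f (i.insertNth q.2 q.1)‖ₑ ^ 2 :=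
    hm.comp ((measurable_insertNth i).comp measurable_swap)
  filter_upwards [ae_lt_top hm2.lintegral_prod_right' h.ne] with r hr
  refine memLp_two_of_lintegral_lt_top ?_ hr
  exact (hfm.comp ((measurable_insertNth i).comp
    measurable_prodMk_right)).aestronglyMeasurable

theorem ae_memLp_update {n : ℕ} (i : Fin n) {f : (Fin n → ℝ × ℝ) → ℂ}
    (hfm : Measurable f) (hf : MemLp f 2 (nMeasure n)) :
    ∀ᵐ k ∂nMeasure n, MemLp (fun p => f (Function.update k i p)) 2 momentumMeasure := by
  cases n with
  | zero => exact i.elim0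
  | succ n =>
    filter_upwards [ae_removeNth i (ae_memLp_insertNth i hfm hf)] with k hk
    simpa [Fin.insertNth_removeNth] using hk

theorem ae_memLp_cons {n : ℕ} (f : Fock (n + 1)) :
    ∀ᵐ k ∂nMeasure n, MemLp (fun p => amp f (Fin.cons p k)) 2 momentumMeasure := by
  simpa [Fin.insertNth_zero'] using ae_memLp_insertNth 0 (measurable_amp f) (memLp_amp f)

/-! ### Cauchy–Schwarz and Hilbert–Schmidt bounds -/

theorem lintegral_mul_sq_le {α : Type*} [MeasurableSpace α] {μ : Measure α} {f g : α → ENNReal}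
    (hf : AEMeasurable f μ) (hg : AEMeasurable g μ) :
    (∫⁻ a, f a * g a ∂μ) ^ 2 ≤ (∫⁻ a, f a ^ 2 ∂μ) * ∫⁻ a, g a ^ 2 ∂μ := by
  have h := ENNReal.lintegral_mul_le_Lp_mul_Lq μ Real.HolderConjugate.two_two hf hg
  calc (∫⁻ a, f a * g a ∂μ) ^ 2
      ≤ ((∫⁻ a, f a ^ (2 : ℝ) ∂μ) ^ (1 / (2 : ℝ)) * (∫⁻ a, g a ^ (2 : ℝ) ∂μ) ^ (1 / (2 : ℝ))) ^ 2 := by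
        gcongr
        exact h
    _ = _ := by
        rw [mul_pow, ← ENNReal.rpow_natCast, ← ENNReal.rpow_natCast, ← ENNReal.rpow_mul,
          ← ENNReal.rpow_mul]
        norm_num

theorem enorm_integral_mul_sq_le {α : Type*} [MeasurableSpace α] {μ : Measure α} {f g : α → ℂ}
    (hf : AEStronglyMeasurable f μ) (hg : AEStronglyMeasurable g μ) :
    ‖∫ a, f a * g a ∂μ‖ₑ ^ 2 ≤ (∫⁻ a, ‖f a‖ₑ ^ 2 ∂μ) * ∫⁻ a, ‖g a‖ₑ ^ 2 ∂μ := by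
  refine le_trans ?_ (lintegral_mul_sq_le hf.enorm hg.enorm)
  gcongr
  simpa only [enorm_mul] using enorm_integral_le_lintegral_enorm (μ := μ) fun a => f a * g a

/-- The Hilbert–Schmidt bound for a kernel acting on the `i`-th momentum, uniformly in the others. -/
theorem lintegral_kernel_le {n : ℕ} (i : Fin (n + 1)) {N : (Fin (n + 1) → ℝ × ℝ) → ℝ × ℝ → ℂ}
    (hN : Measurable (Function.uncurry N)) {f : (Fin (n + 1) → ℝ × ℝ) → ℂ} (hf : Measurable f)
    {C : ENNReal} (hC : ∀ᵐ r ∂nMeasure n,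
      ∫⁻ x, ∫⁻ y, ‖N (i.insertNth x r) y‖ₑ ^ 2 ∂momentumMeasure ∂momentumMeasure ≤ C) :
    ∫⁻ k, ‖∫ y, N k y * f (Function.update k i y) ∂momentumMeasure‖ₑ ^ 2 ∂nMeasure (n + 1) ≤
      C * ∫⁻ k, ‖f k‖ₑ ^ 2 ∂nMeasure (n + 1) := by
  have hins : Measurable fun q : (Fin n → ℝ × ℝ) × (ℝ × ℝ) =>
      (i.insertNth q.2 q.1 : Fin (n + 1) → ℝ × ℝ) :=
    (measurable_insertNth i).comp measurable_swap
  have hupd : Measurable fun q : (Fin (n + 1) → ℝ × ℝ) × (ℝ × ℝ) =>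
      f (Function.update q.1 i q.2) := hf.comp measurable_update'
  have hm : Measurable fun k => ‖∫ y, N k y * f (Function.update k i y) ∂momentumMeasure‖ₑ ^ 2 := by
    have : StronglyMeasurable fun k => ∫ y, N k y * f (Function.update k i y) ∂momentumMeasure :=
      StronglyMeasurable.integral_prod_right (f := fun k y => N k y * f (Function.update k i y))
        (hN.mul hupd).stronglyMeasurable
    exact this.measurable.enorm.pow_const 2
  have hf2 : Measurable fun k => ‖f k‖ₑ ^ 2 := by fun_prop
  have hf3 : Measurable fun r : Fin n → ℝ × ℝ =>
      ∫⁻ p, ‖f (i.insertNth p r)‖ₑ ^ 2 ∂momentumMeasure :=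
    (hf2.comp hins).lintegral_prod_right'
  rw [lintegral_insertNth i hm, lintegral_insertNth i hf2, ← lintegral_const_mul _ hf3]
  refine lintegral_mono_ae ?_
  filter_upwards [hC] with r hr
  have hfr : Measurable fun y => f (i.insertNth y r) := hf.comp (hins.comp measurable_prodMk_left)
  have hNr : Measurable fun q : (ℝ × ℝ) × (ℝ × ℝ) => N (i.insertNth q.1 r) q.2 :=
    hN.comp ((hins.comp (measurable_const.prodMk measurable_fst)).prodMk measurable_snd)
  -- Cauchy–Schwarz in y with the other momenta `r` fixed; the factor containing `f` does not depend
  -- on x and comes out of the x-integral.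
  calc _ ≤ ∫⁻ x, (∫⁻ y, ‖N (i.insertNth x r) y‖ₑ ^ 2 ∂momentumMeasure) *
        ∫⁻ y, ‖f (i.insertNth y r)‖ₑ ^ 2 ∂momentumMeasure ∂momentumMeasure := by
        refine lintegral_mono fun x => ?_
        simp only [Fin.update_insertNth]
        exact enorm_integral_mul_sq_le
          (hNr.comp measurable_prodMk_left).aestronglyMeasurable hfr.aestronglyMeasurable
    _ ≤ _ := by
        rw [lintegral_mul_const]
        · gcongr
        · exact Measurable.lintegral_prod_right' (f := fun q : (ℝ × ℝ) × (ℝ × ℝ) =>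
            ‖N (i.insertNth q.1 r) q.2‖ₑ ^ 2) (hNr.enorm.pow_const 2)

/-- Bounded functions of the free Hamiltonian are bounded operators. -/
theorem exists_clm_funH0 (m : ℝ) (n : ℕ) {s : ℝ → ℂ} (hs : Measurable s) {C : ℝ} (hC : 0 ≤ C)
    (hsC : ∀ h : ℝ, n * m ≤ h → ‖s h‖ ≤ C) :
    ∃ T : Fock n →L[ℂ] Fock n, ‖T‖ ≤ C ∧ ∀ x y, (x, y) ∈ (funH0 m n s).graph ↔ T x = y := by
  lift C to NNReal using hC
  have hbound : ∀ ψ : Fock n, ∫⁻ k, ‖s (freeEnergy m k) * amp ψ k‖ₑ ^ 2 ∂nMeasure n ≤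
      (C : ENNReal) ^ 2 * ∫⁻ k, ‖amp ψ k‖ₑ ^ 2 ∂nMeasure n := by
    intro ψ
    have := measurable_amp ψ
    rw [← lintegral_const_mul _ (by fun_prop)]
    refine lintegral_mono_ae ?_
    filter_upwards [ae_le_freeEnergy m n] with k hk
    rw [enorm_mul, mul_pow]
    gcongr
    rw [enorm_eq_nnnorm, ENNReal.coe_le_coe]
    exact hsC _ hk
  refine exists_clm_of_rel _ C C.2 (fun x y x' y' h h' => (funH0 m n s).graph.add_mem h h')
    (fun c x y h => (funH0 m n s).graph.smul_mem c h) (fun ψ => ?_) fun ψ χ h => ?_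
  · have hmeas : Measurable fun k => s (freeEnergy m k) * amp ψ k :=
      (hs.comp (measurable_freeEnergy m n)).mul (measurable_amp ψ)
    obtain ⟨χ, hχ⟩ := exists_amp_eq (f := fun k => s (freeEnergy m k) * amp ψ k)
      (memLp_two_of_lintegral_lt_top hmeas.aestronglyMeasurable ((hbound ψ).trans_lt
        (ENNReal.mul_lt_top (by simp) (MemLp.lintegral_sq_lt_top (memLp_amp ψ)))))
      (fun σ => by
        filter_upwards [ae_amp_comp_perm ψ σ] with k hk
        rw [freeEnergy_comp_perm, hk])
    exact ⟨χ, (mem_graph_funH0 m n s ψ χ).2 hχ⟩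
  · exact norm_le_of_lintegral_le ((mem_graph_funH0 m n s ψ χ).1 h) (hbound ψ)

theorem update_comp_perm {n : ℕ} (k : Fin n → ℝ × ℝ) (σ : Equiv.Perm (Fin n)) (i : Fin n)
    (p : ℝ × ℝ) : Function.update (k ∘ σ) i p = Function.update k (σ i) p ∘ σ := by
  rw [Function.update_comp_equiv]
  simp

/-! ### Kernels acting on one momentum -/

theorem freeEnergy_update (m : ℝ) {n : ℕ} (k : Fin n → ℝ × ℝ) (i : Fin n) (p : ℝ × ℝ) :
    freeEnergy m (Function.update k i p) = omega m p + (freeEnergy m k - omega m (k i)) := by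
  cases n with
  | zero => exact i.elim0
  | succ n =>
    have h1 : k = i.insertNth (k i) (i.removeNth k) := by simp
    have h2 : Function.update k i p = i.insertNth p (i.removeNth k) := by simp
    have h3 : freeEnergy m k = omega m (k i) + freeEnergy m (i.removeNth k) := by
      conv_lhs => rw [h1]
      exact freeEnergy_insertNth ..
    rw [h2, freeEnergy_insertNth, h3]
    ring

theorem le_freeEnergy_sub (m : ℝ) {n : ℕ} {k : Fin n → ℝ × ℝ} (hk : ∀ i, 0 < (k i).1)
    (i : Fin n) : m * ((n : ℝ) - 1) ≤ freeEnergy m k - omega m (k i) := by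
  cases n with
  | zero => exact i.elim0
  | succ n =>
    have h := le_freeEnergy m (k := i.removeNth k) fun j => hk _
    have h1 : k = i.insertNth (k i) (i.removeNth k) := by simp
    have h3 : freeEnergy m k = omega m (k i) + freeEnergy m (i.removeNth k) := by
      conv_lhs => rw [h1]
      exact freeEnergy_insertNth ..
    rw [h3]
    push_cast
    linarith

/-- A kernel for the `i`-th momentum is uniformly Hilbert–Schmidt with squared norm at most `C`. -/
def IsHSKernel {n : ℕ} (i : Fin n) (N : (Fin n → ℝ × ℝ) → ℝ × ℝ → ℂ) (C : ENNReal) : Prop :=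
  Measurable (Function.uncurry N) ∧ ∀ k : Fin n → ℝ × ℝ, (∀ j, 0 < (k j).1) →
    ∫⁻ x, ∫⁻ y, ‖N (Function.update k i x) y‖ₑ ^ 2 ∂momentumMeasure ∂momentumMeasure ≤ C

theorem IsHSKernel.ae_insertNth {n : ℕ} {i : Fin (n + 1)}
    {N : (Fin (n + 1) → ℝ × ℝ) → ℝ × ℝ → ℂ} {C : ENNReal} (h : IsHSKernel i N C)
    {r : Fin n → ℝ × ℝ} (hr : ∀ j, 0 < (r j).1) :
    ∫⁻ x, ∫⁻ y, ‖N (i.insertNth x r) y‖ₑ ^ 2 ∂momentumMeasure ∂momentumMeasure ≤ C := by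
  -- The `i`-th entry is overwritten by the update in the definition, so any point with positive
  -- first component serves.
  have := h.2 (i.insertNth (1, 0) r) fun j => by
    rcases Fin.eq_self_or_eq_succAbove i j with rfl | ⟨j, rfl⟩
    · simp
    · simpa using hr j
  simpa only [Fin.update_insertNth] using this

theorem IsHSKernel.lintegral_le {n : ℕ} {i : Fin n} {N : (Fin n → ℝ × ℝ) → ℝ × ℝ → ℂ}
    {C : ENNReal} (h : IsHSKernel i N C) {f : (Fin n → ℝ × ℝ) → ℂ} (hf : Measurable f) :
    ∫⁻ k, ‖∫ y, N k y * f (Function.update k i y) ∂momentumMeasure‖ₑ ^ 2 ∂nMeasure n ≤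
      C * ∫⁻ k, ‖f k‖ₑ ^ 2 ∂nMeasure n := by
  cases n with
  | zero => exact i.elim0
  | succ n =>
    exact lintegral_kernel_le i h.1 hf
      ((ae_momenta_pos n).mono fun r hr => h.ae_insertNth hr)

theorem IsHSKernel.measurable_integral {n : ℕ} {i : Fin n} {N : (Fin n → ℝ × ℝ) → ℝ × ℝ → ℂ}
    {C : ENNReal} (h : IsHSKernel i N C) {f : (Fin n → ℝ × ℝ) → ℂ} (hf : Measurable f) :
    Measurable fun k => ∫ y, N k y * f (Function.update k i y) ∂momentumMeasure := by
  have : StronglyMeasurable fun k => ∫ y, N k y * f (Function.update k i y) ∂momentumMeasure :=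
    StronglyMeasurable.integral_prod_right (f := fun k y => N k y * f (Function.update k i y))
      (h.1.mul (hf.comp measurable_update')).stronglyMeasurable
  exact this.measurable

theorem IsHSKernel.memLp {n : ℕ} {i : Fin n} {N : (Fin n → ℝ × ℝ) → ℝ × ℝ → ℂ}
    {C : NNReal} (h : IsHSKernel i N C) (ψ : Fock n) :
    MemLp (fun k => ∫ y, N k y * amp ψ (Function.update k i y) ∂momentumMeasure) 2
      (nMeasure n) :=
  memLp_two_of_lintegral_lt_top (h.measurable_integral (measurable_amp ψ)).aestronglyMeasurable
    ((h.lintegral_le (measurable_amp ψ)).trans_lt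
      (ENNReal.mul_lt_top (by simp) (MemLp.lintegral_sq_lt_top (memLp_amp ψ))))

/-- Minkowski's inequality for n terms; this is the source of the factor n in the bound on the
relative potential. -/
theorem lintegral_sum_sq_le {α : Type*} [MeasurableSpace α] {μ : Measure α} {n : ℕ}
    {g : Fin n → α → ℂ} (hg : ∀ i, AEStronglyMeasurable (g i) μ) {C A : ENNReal}
    (h : ∀ i, ∫⁻ a, ‖g i a‖ₑ ^ 2 ∂μ ≤ C ^ 2 * A ^ 2) :
    ∫⁻ a, ‖∑ i, g i a‖ₑ ^ 2 ∂μ ≤ (n * C) ^ 2 * A ^ 2 := by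
  have h1 : ∀ i, eLpNorm (g i) 2 μ ≤ C * A := by
    intro i
    refine (ENNReal.pow_le_pow_left_iff two_ne_zero).1 ?_
    rw [eLpNorm_two_sq, mul_pow]
    exact h i
  rw [← eLpNorm_two_sq, ← mul_pow]
  gcongr
  have h2 := eLpNorm_sum_le (s := Finset.univ) (f := g) (p := 2) (μ := μ) (fun i _ => hg i)
    (by norm_num)
  have h3 : (∑ i, g i) = fun a => ∑ i, g i a := by ext a; simp
  rw [h3] at h2
  refine h2.trans ((Finset.sum_le_sum fun i _ => h1 i).trans ?_)
  simp [mul_assoc]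

theorem IsHSKernel.sum_lintegral_le {n : ℕ} {N : Fin n → (Fin n → ℝ × ℝ) → ℝ × ℝ → ℂ}
    {C : ENNReal} (h : ∀ i, IsHSKernel i (N i) (C ^ 2)) (ψ : Fock n) :
    ∫⁻ k, ‖∑ i, ∫ y, N i k y * amp ψ (Function.update k i y) ∂momentumMeasure‖ₑ ^ 2 ∂nMeasure n ≤
      (n * C) ^ 2 * ∫⁻ k, ‖amp ψ k‖ₑ ^ 2 ∂nMeasure n := by
  rw [← enorm_sq_eq_lintegral]
  refine lintegral_sum_sq_le
    (fun i => ((h i).measurable_integral (measurable_amp ψ)).aestronglyMeasurable) fun i => ?_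
  rw [enorm_sq_eq_lintegral]
  exact (h i).lintegral_le (measurable_amp ψ)

/-- A real symmetric Hilbert–Schmidt kernel gives a symmetric form. -/
theorem IsHSKernel.integral_symm {n : ℕ} {i : Fin n} {N : (Fin n → ℝ × ℝ) → ℝ × ℝ → ℂ}
    {C : NNReal} (h : IsHSKernel i N C)
    (hsym : ∀ k : Fin n → ℝ × ℝ, (∀ j, 0 < (k j).1) → ∀ p, 0 < p.1 →
      (starRingEnd ℂ) (N k p) = N (Function.update k i p) (k i)) (φ ψ : Fock n) :
    ∫ k, (∫ y, N k y * amp ψ (Function.update k i y) ∂momentumMeasure) *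
        (starRingEnd ℂ) (amp φ k) ∂nMeasure n =
      ∫ k, amp ψ k * (starRingEnd ℂ)
        (∫ y, N k y * amp φ (Function.update k i y) ∂momentumMeasure) ∂nMeasure n := by
  cases n with
  | zero => exact i.elim0
  | succ n =>
    rw [integral_insertNth i (integrable_mul_conj (h.memLp ψ) (memLp_amp φ)),
      integral_insertNth i (integrable_mul_conj (memLp_amp ψ) (h.memLp φ))]
    refine integral_congr_ae ?_
    filter_upwards [ae_momenta_pos n, ae_memLp_insertNth i (measurable_amp ψ) (memLp_amp ψ),
      ae_memLp_insertNth i (measurable_amp φ) (memLp_amp φ)] with r hr hψ hφ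
    simp only [Fin.update_insertNth, ← integral_mul_const, ← integral_conj, ← integral_const_mul]
    have hins : Measurable fun x : ℝ × ℝ => (i.insertNth x r : Fin (n + 1) → ℝ × ℝ) :=
      (measurable_insertNth i).comp measurable_prodMk_right
    have hNr : Measurable fun q : (ℝ × ℝ) × (ℝ × ℝ) => N (i.insertNth q.1 r) q.2 :=
      h.1.comp ((hins.comp measurable_fst).prodMk measurable_snd)
    -- Fubini on the fibre needs joint integrability: the kernel and the product of the two
    -- amplitudes are both square integrable on the product space.
    have hN2 : MemLp (fun q : (ℝ × ℝ) × (ℝ × ℝ) => N (i.insertNth q.1 r) q.2) 2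
        (momentumMeasure.prod momentumMeasure) := by
      refine memLp_two_of_lintegral_lt_top hNr.aestronglyMeasurable ?_
      rw [lintegral_prod _ (hNr.enorm.pow_const 2).aemeasurable]
      exact (h.ae_insertNth hr).trans_lt (by simp)
    have hprod : MemLp (fun q : (ℝ × ℝ) × (ℝ × ℝ) => amp ψ (i.insertNth q.2 r) *
        (starRingEnd ℂ) (amp φ (i.insertNth q.1 r))) 2
        (momentumMeasure.prod momentumMeasure) := by
      have hmψ : Measurable fun x => amp ψ (i.insertNth x r) := (measurable_amp ψ).comp hins
      have hmφ : Measurable fun x => amp φ (i.insertNth x r) := (measurable_amp φ).comp hins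
      refine memLp_two_of_lintegral_lt_top (Measurable.aestronglyMeasurable ?_) ?_
      · exact (hmψ.comp measurable_snd).mul
          (Complex.continuous_conj.measurable.comp (hmφ.comp measurable_fst))
      · simp only [enorm_mul, mul_pow, RCLike.enorm_conj]
        have := lintegral_prod_mul (μ := momentumMeasure) (ν := momentumMeasure)
          (f := fun x => ‖amp φ (i.insertNth x r)‖ₑ ^ 2)
          (g := fun x => ‖amp ψ (i.insertNth x r)‖ₑ ^ 2)
          (hmφ.enorm.pow_const 2).aemeasurable (hmψ.enorm.pow_const 2).aemeasurable
        simp only [mul_comm (‖amp ψ _‖ₑ ^ 2)]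
        rw [this]
        exact ENNReal.mul_lt_top (MemLp.lintegral_sq_lt_top hφ) (MemLp.lintegral_sq_lt_top hψ)
    have hint := hN2.integrable_mul hprod
    have hswap := integral_integral_swap (μ := momentumMeasure) (ν := momentumMeasure)
      (f := fun x y => N (i.insertNth x r) y * (amp ψ (i.insertNth y r) *
        (starRingEnd ℂ) (amp φ (i.insertNth x r)))) hint
    simp only [mul_assoc]
    rw [hswap]
    refine integral_congr_ae ?_
    filter_upwards [ae_momentum_pos] with y hy
    refine integral_congr_ae ?_
    filter_upwards [ae_momentum_pos] with x hx
    have hs := hsym (i.insertNth y r) (fun j => by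
      rcases Fin.eq_self_or_eq_succAbove i j with rfl | ⟨j, rfl⟩
      · simpa using hy
      · simpa using hr j) x hx
    rw [map_mul, hs, Fin.update_insertNth, Fin.insertNth_apply_same]
    ring

/-! ### The kinetic symbol -/

theorem neg_lt_re_freeEnergy_sub {m : ℝ} {n : ℕ} {E : ℂ} (hE : E.re < n * m + m) {h : ℝ}
    (hh : n * m ≤ h) : -m < ((h : ℂ) - E).re := by
  simp only [Complex.sub_re, Complex.ofReal_re]
  linarith

theorem measurable_kineticSymbol (m mu lam : ℝ) (E : ℂ) :
    Measurable (kineticSymbol m mu lam E) := by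
  have hm := measurable_omega m
  have : StronglyMeasurable fun h : ℝ => ∫ k, (1 / ((omega m k : ℂ) - mu) -
      1 / ((h : ℂ) - E + omega m k)) ∂momentumMeasure := by
    refine StronglyMeasurable.integral_prod_right (f := fun (h : ℝ) k =>
      (1 / ((omega m k : ℂ) - mu) - 1 / ((h : ℂ) - E + omega m k))) ?_
    refine Measurable.stronglyMeasurable ?_
    unfold Function.uncurry
    fun_prop
  have h2 := this.measurable
  unfold kineticSymbol
  fun_prop

/-- The renormalization at work: the difference equals (z + μ_p)/((ω - μ_p)(z + ω)), a multiple of a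
product of two L² functions. -/
theorem integrable_kineticSymbol {m mu : ℝ} (hm : 0 < m) (hmu : mu < m) {z : ℂ}
    (hz : -m < z.re) :
    Integrable (fun k => 1 / ((omega m k : ℂ) - mu) - 1 / (z + omega m k)) momentumMeasure := by
  have h := (integrable_inv_mul_inv hm (z := ((-mu : ℝ) : ℂ)) (w := z)
    (by simpa using hmu) hz).const_mul (z + mu)
  refine h.congr ?_
  filter_upwards [ae_le_omega m] with k hk
  have h1 : ((-mu : ℝ) : ℂ) + omega m k ≠ 0 := by
    rw [← Complex.ofReal_add]
    exact Complex.ofReal_ne_zero.2 (by linarith)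
  have h2 : z + omega m k ≠ 0 := by
    intro h0
    have := congrArg Complex.re h0
    simp at this
    linarith
  have h3 : ((omega m k : ℂ) - mu) ≠ 0 := by
    convert h1 using 1
    push_cast
    ring
  have h4 : ((-mu : ℝ) : ℂ) + omega m k = (omega m k : ℂ) - mu := by push_cast; ring
  rw [h4]
  field_simp
  ring

/-- At real energies below the threshold the kinetic symbol is real and bounded below by
`h - E + μ_p`. -/
theorem exists_kineticSymbol_eq {m mu : ℝ} (lam : ℝ) (hmu : mu < m) {E h : ℝ}
    (hh : 0 < h - E + mu) :
    ∃ x : ℝ, h - E + mu ≤ x ∧ kineticSymbol m mu lam E h = x := by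
  refine ⟨(h - E + mu) + lam ^ 2 * ∫ k, (1 / (omega m k - mu) - 1 / (h - E + omega m k))
    ∂momentumMeasure, ?_, ?_⟩
  · refine le_add_of_nonneg_right (mul_nonneg (sq_nonneg _) (integral_nonneg_of_ae ?_))
    filter_upwards [ae_le_omega m] with k hk
    simp only [Pi.zero_apply, sub_nonneg]
    -- Since h - E > -μ_p, the subtracted fraction has the larger denominator.
    exact one_div_le_one_div_of_le (by linarith) (by linarith)
  · rw [kineticSymbol]
    push_cast
    congr 2
    rw [← integral_complex_ofReal]
    push_cast
    rfl

/-! ### The potential relative to the kinetic part -/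

/-- The symbol of `K(E)^{-1/2}`. -/
def invSqrtSymbol (m mu lam : ℝ) (E : ℂ) (h : ℝ) : ℂ :=
  kineticSymbol m mu lam E h ^ (-(1 / 2) : ℂ)

theorem measurable_invSqrtSymbol (m mu lam : ℝ) (E : ℂ) :
    Measurable (invSqrtSymbol m mu lam E) :=
  (measurable_kineticSymbol m mu lam E).pow_const _

/-- At low real energies the complex power in the symbol is a positive real number. The last clause
says that the symbol squared inverts that of K(E). -/
theorem exists_invSqrtSymbol_eq {m mu : ℝ} (lam : ℝ) (hmu : mu < m) {E h : ℝ}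
    (hh : 0 < h - E + mu) :
    ∃ y : ℝ, 0 < y ∧ invSqrtSymbol m mu lam E h = y ∧ y ^ 2 ≤ (h - E + mu)⁻¹ ∧
      kineticSymbol m mu lam E h * (y * y) = 1 := by
  obtain ⟨x, hx, hs⟩ := exists_kineticSymbol_eq lam hmu hh
  have hx0 : 0 < x := hh.trans_le hx
  have hsq : x ^ (-(1 / 2) : ℝ) * x ^ (-(1 / 2) : ℝ) = x⁻¹ := by
    rw [← Real.rpow_add hx0, ← Real.rpow_neg_one]
    norm_num
  refine ⟨x ^ (-(1 / 2) : ℝ), by positivity, ?_, ?_, ?_⟩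
  · rw [invSqrtSymbol, hs, Complex.ofReal_cpow hx0.le]
    norm_num
  · rw [sq, hsq]
    gcongr
  · rw [hs, ← Complex.ofReal_mul, hsq, ← Complex.ofReal_mul, mul_inv_cancel₀ hx0.ne',
      Complex.ofReal_one]

/-- The kernel of `t(H₀) U(E) s(H₀)` in the `i`-th momentum. -/
def pairKernel (m lam : ℝ) {n : ℕ} (E : ℂ) (t s : ℝ → ℂ) (i : Fin n) (k : Fin n → ℝ × ℝ)
    (p : ℝ × ℝ) : ℂ :=
  t (freeEnergy m k) * ((lam : ℂ) ^ 2 * ((freeEnergy m k : ℂ) - E + omega m p)⁻¹ *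
    s (freeEnergy m (Function.update k i p)))

theorem measurable_pairKernel (m lam : ℝ) {n : ℕ} (E : ℂ) {t s : ℝ → ℂ} (ht : Measurable t)
    (hs : Measurable s) (i : Fin n) :
    Measurable (Function.uncurry (pairKernel m lam E t s i)) := by
  have h1 : Measurable fun q : (Fin n → ℝ × ℝ) × (ℝ × ℝ) => freeEnergy m q.1 :=
    (measurable_freeEnergy m n).comp measurable_fst
  have h2 : Measurable fun q : (Fin n → ℝ × ℝ) × (ℝ × ℝ) => omega m q.2 :=
    (measurable_omega m).comp measurable_snd
  have h3 : Measurable fun q : (Fin n → ℝ × ℝ) × (ℝ × ℝ) =>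
      freeEnergy m (Function.update q.1 i q.2) :=
    (measurable_freeEnergy m n).comp measurable_update'
  have h4 := ht.comp h1
  have h5 := hs.comp h3
  simp only [Function.comp_def] at h4 h5
  unfold pairKernel Function.uncurry
  fun_prop

/-- The pointwise bound behind both Hilbert–Schmidt estimates. -/
theorem norm_sq_pairKernel_one_le {m mu : ℝ} (lam : ℝ) (hmu : mu < m) {n : ℕ} {E : ℝ}
    (hE : E < m * ((n : ℝ) - 1) + mu) (i : Fin n) {k : Fin n → ℝ × ℝ} (hk : ∀ j, 0 < (k j).1)
    {x y : ℝ × ℝ} (hx : m ≤ omega m x) (hy : m ≤ omega m y) (hm : 0 < m) :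
    ‖pairKernel m lam E (fun _ => 1) (invSqrtSymbol m mu lam E) i (Function.update k i x) y‖ ^ 2 ≤
      4 * lam ^ 4 * (((omega m x + (omega m y + 2 * (m * ((n : ℝ) - 1) + mu - E))) ^ 2)⁻¹ *
        (omega m y + (m * ((n : ℝ) - 1) + mu - E))⁻¹) := by
  have hr := le_freeEnergy_sub m hk i
  set c := m * ((n : ℝ) - 1) + mu - E with hc
  have hc0 : 0 < c := by linarith
  simp only [pairKernel, Function.update_idem, freeEnergy_update, one_mul]
  obtain ⟨v, hv0, hv, hv2, -⟩ := exists_invSqrtSymbol_eq lam hmu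
    (E := E) (h := omega m y + (freeEnergy m k - omega m (k i))) (by linarith)
  have hv3 : v ^ 2 ≤ (omega m y + c)⁻¹ := by
    exact hv2.trans (inv_anti₀ (by linarith) (by linarith))
  rw [hv, ← Complex.ofReal_sub, ← Complex.ofReal_add, ← Complex.ofReal_inv, ← Complex.ofReal_pow,
    ← Complex.ofReal_mul, ← Complex.ofReal_mul, Complex.norm_real, Real.norm_eq_abs, sq_abs,
    mul_pow, mul_pow, inv_pow]
  -- The rest energy is at least m(n-1), and half of ω(x) + ω(y) is at least m > μ_p, so it can be
  -- given up to turn c - μ_p into c. Squaring the factor 1/2 produces the 4 in the bound.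
  have hd : (omega m x + (omega m y + 2 * c)) / 2 ≤
      omega m x + (freeEnergy m k - omega m (k i)) - E + omega m y := by linarith
  have hd0 : 0 < (omega m x + (omega m y + 2 * c)) / 2 := by linarith
  have h1 : 0 ≤ (omega m y + c)⁻¹ := inv_nonneg.2 (by linarith)
  calc _ ≤ (lam ^ 2) ^ 2 * (((omega m x + (omega m y + 2 * c)) / 2) ^ 2)⁻¹ *
        (omega m y + c)⁻¹ := by gcongr
    _ = _ := by
      rw [div_pow, inv_div]
      ring

/-- This one-sided estimate for U(E) K(E)^{-1/2} removes any domain question for the two-sided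
product. The x-integral gives at most 1/(4π(ω(y) + c)), which combines with the K-factor to (ω(y) +
c)⁻² and is integrated once more. -/
theorem isHSKernel_potential_mul {m mu : ℝ} (lam : ℝ) (hm : 0 < m) (hmu : mu < m) {n : ℕ} {E : ℝ}
    (hE : E < m * ((n : ℝ) - 1) + mu) : ∃ C : NNReal, ∀ i : Fin n,
      IsHSKernel i (pairKernel m lam E (fun _ => 1) (invSqrtSymbol m mu lam E) i)
        ((C : ENNReal) ^ 2) := by
  have hmeas := measurable_omega m
  set c := m * ((n : ℝ) - 1) + mu - E with hc
  have hc0 : 0 < c := by linarith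
  let B : NNReal := Real.toNNReal (4 * lam ^ 4 * (1 / (4 * Real.pi) * (1 / (4 * Real.pi * c))))
  refine ⟨NNReal.sqrt B, fun i => ⟨measurable_pairKernel m lam E measurable_const
    (measurable_invSqrtSymbol m mu lam E) i, fun k hk => ?_⟩⟩
  rw [← ENNReal.coe_pow, NNReal.sq_sqrt]
  calc
    _ ≤ ∫⁻ x, ∫⁻ y, ENNReal.ofReal (4 * lam ^ 4) *
        (ENNReal.ofReal (((omega m x + (omega m y + 2 * c)) ^ 2)⁻¹) *
          ENNReal.ofReal ((omega m y + c)⁻¹)) ∂momentumMeasure ∂momentumMeasure := by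
        refine lintegral_mono_ae ?_
        filter_upwards [ae_le_omega m] with x hx
        refine lintegral_mono_ae ?_
        filter_upwards [ae_le_omega m] with y hy
        rw [← ENNReal.ofReal_mul (by positivity), ← ENNReal.ofReal_mul (by positivity),
          ← ofReal_norm, ← ENNReal.ofReal_pow (norm_nonneg _)]
        exact ENNReal.ofReal_le_ofReal (norm_sq_pairKernel_one_le lam hmu hE i hk hx hy hm)
    _ = ENNReal.ofReal (4 * lam ^ 4) * ∫⁻ y, (∫⁻ x,
        ENNReal.ofReal (((omega m x + (omega m y + 2 * c)) ^ 2)⁻¹) ∂momentumMeasure) *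
          ENNReal.ofReal ((omega m y + c)⁻¹) ∂momentumMeasure := by
        rw [lintegral_lintegral_swap, ← lintegral_const_mul]
        · refine lintegral_congr fun y => ?_
          rw [lintegral_const_mul _ (by fun_prop), lintegral_mul_const _ (by fun_prop)]
        · refine Measurable.mul ?_ (by fun_prop)
          exact Measurable.lintegral_prod_left' (f := fun q : (ℝ × ℝ) × (ℝ × ℝ) =>
            ENNReal.ofReal (((omega m q.1 + (omega m q.2 + 2 * c)) ^ 2)⁻¹)) (by fun_prop)
        · exact Measurable.aemeasurable (by fun_prop)
    _ ≤ ENNReal.ofReal (4 * lam ^ 4) * ∫⁻ y, ENNReal.ofReal (1 / (4 * Real.pi)) *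
          ENNReal.ofReal (((omega m y + c) ^ 2)⁻¹) ∂momentumMeasure := by
        refine mul_le_mul_right (lintegral_mono_ae ?_) _
        filter_upwards [ae_le_omega m] with y hy
        have hy0 : 0 < omega m y + c := by linarith
        have hy1 : 0 < omega m y + 2 * c := by linarith
        refine (mul_le_mul_left
          (lintegral_inv_omega_add_sq_le m (c := omega m y + 2 * c) (by linarith)) _).trans ?_
        rw [← ENNReal.ofReal_mul (by positivity),
          ← ENNReal.ofReal_mul (by positivity)]
        refine ENNReal.ofReal_le_ofReal ?_
        calc _ ≤ 1 / (4 * Real.pi * (omega m y + c)) * (omega m y + c)⁻¹ := by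
              gcongr
              linarith
          _ = _ := by field_simp
    _ ≤ _ := by
        rw [lintegral_const_mul _ (by fun_prop)]
        refine (mul_le_mul_right (mul_le_mul_right
          (lintegral_inv_omega_add_sq_le m hc0) _) _).trans ?_
        rw [← ENNReal.ofReal_mul (by positivity), ← ENNReal.ofReal_mul (by positivity)]
        rfl

/-- The second factor K^{-1/2} makes the squared kernel at most λ⁴/((ω(x) + c)²(ω(y) + c)²), which
factorizes; each integral contributes 1/(4πc). -/
theorem isHSKernel_relative {m mu : ℝ} (lam : ℝ) (hm : 0 < m) (hmu : mu < m) {n : ℕ} {E : ℝ}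
    (hE : E < m * ((n : ℝ) - 1) + mu) (i : Fin n) :
      IsHSKernel i (pairKernel m lam E (invSqrtSymbol m mu lam E) (invSqrtSymbol m mu lam E) i)
        ((Real.toNNReal (lam ^ 2 / (4 * Real.pi * (m * ((n : ℝ) - 1) + mu - E))) : ENNReal) ^ 2) := by
  have hmeas := measurable_omega m
  refine ⟨measurable_pairKernel m lam E (measurable_invSqrtSymbol m mu lam E)
    (measurable_invSqrtSymbol m mu lam E) i, fun k hk => ?_⟩
  have hr := le_freeEnergy_sub m hk i
  have hone : ∀ x y, pairKernel m lam E (invSqrtSymbol m mu lam E) (invSqrtSymbol m mu lam E) i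
      (Function.update k i x) y =
      invSqrtSymbol m mu lam E (omega m x + (freeEnergy m k - omega m (k i))) *
      pairKernel m lam E (fun _ => 1) (invSqrtSymbol m mu lam E) i (Function.update k i x) y := by
    intro x y
    simp [pairKernel, freeEnergy_update]
  have hpt := fun x y => norm_sq_pairKernel_one_le lam hmu hE i hk (x := x) (y := y)
  set c := m * ((n : ℝ) - 1) + mu - E with hc
  have hc0 : 0 < c := by linarith
  calc
    _ ≤ ∫⁻ x, ∫⁻ y, ENNReal.ofReal (lam ^ 4) * (ENNReal.ofReal (((omega m x + c) ^ 2)⁻¹) *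
          ENNReal.ofReal (((omega m y + c) ^ 2)⁻¹)) ∂momentumMeasure ∂momentumMeasure := by
        refine lintegral_mono_ae ?_
        filter_upwards [ae_le_omega m] with x hx
        refine lintegral_mono_ae ?_
        filter_upwards [ae_le_omega m] with y hy
        rw [← ENNReal.ofReal_mul (by positivity), ← ENNReal.ofReal_mul (by positivity),
          ← ofReal_norm, ← ENNReal.ofReal_pow (norm_nonneg _)]
        refine ENNReal.ofReal_le_ofReal ?_
        rw [hone, norm_mul, mul_pow]
        obtain ⟨v, hv0, hv, hv2, -⟩ := exists_invSqrtSymbol_eq lam hmu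
          (E := E) (h := omega m x + (freeEnergy m k - omega m (k i))) (by linarith)
        have hX : 0 < omega m x + c := by linarith
        have hY : 0 < omega m y + c := by linarith
        have hv3 : v ^ 2 ≤ (omega m x + c)⁻¹ := by
          exact hv2.trans (inv_anti₀ (by linarith) (by linarith))
        rw [hv, Complex.norm_real, Real.norm_eq_abs, sq_abs]
        calc _ ≤ (omega m x + c)⁻¹ * (4 * lam ^ 4 *
              (((omega m x + (omega m y + 2 * c)) ^ 2)⁻¹ * (omega m y + c)⁻¹)) := by
              gcongr
              exact hpt x y hx hy hm
          -- AM–GM: (X + Y)² ≥ 4XY with X = ω(x) + c and Y = ω(y) + c.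
          _ ≤ (omega m x + c)⁻¹ * (4 * lam ^ 4 *
              ((4 * ((omega m x + c) * (omega m y + c)))⁻¹ * (omega m y + c)⁻¹)) := by
              gcongr
              nlinarith [sq_nonneg (omega m x - omega m y)]
          _ = _ := by field_simp
    _ = ENNReal.ofReal (lam ^ 4) * ((∫⁻ x, ENNReal.ofReal (((omega m x + c) ^ 2)⁻¹)
          ∂momentumMeasure) * ∫⁻ y, ENNReal.ofReal (((omega m y + c) ^ 2)⁻¹)
            ∂momentumMeasure) := by
        rw [← lintegral_mul_const _ (by fun_prop), ← lintegral_const_mul _ (by fun_prop)]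
        refine lintegral_congr fun x => ?_
        rw [lintegral_const_mul _ (by fun_prop), lintegral_const_mul _ (by fun_prop)]
    _ ≤ _ := by
        have h1 := lintegral_inv_omega_add_sq_le m hc0
        refine (mul_le_mul_right (mul_le_mul' h1 h1) _).trans ?_
        rw [← ENNReal.ofReal_mul (by positivity), ← ENNReal.ofReal_mul (by positivity)]
        change _ ≤ ENNReal.ofReal _ ^ 2
        rw [← ENNReal.ofReal_pow (by positivity)]
        refine ENNReal.ofReal_le_ofReal (le_of_eq ?_)
        field_simp

/-- Exchanging `k i` and `p` fixes the denominator and interchanges the two factors K^{-1/2}; all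
factors are real at these energies. -/
theorem conj_relativeKernel {m mu : ℝ} (lam : ℝ) (hmu : mu < m) {n : ℕ} {E : ℝ}
    (hE : E < m * ((n : ℝ) - 1) + mu) (i : Fin n) {k : Fin n → ℝ × ℝ} (hk : ∀ j, 0 < (k j).1)
    {p : ℝ × ℝ} (hp : 0 < p.1) (hm : 0 < m) :
    (starRingEnd ℂ)
      (pairKernel m lam E (invSqrtSymbol m mu lam E) (invSqrtSymbol m mu lam E) i k p) =
    pairKernel m lam E (invSqrtSymbol m mu lam E) (invSqrtSymbol m mu lam E) i
      (Function.update k i p) (k i) := by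
  have hr := le_freeEnergy_sub m hk i
  have hki := le_omega (m := m) (hk i)
  have hpp := le_omega (m := m) hp
  obtain ⟨v, -, hv, -⟩ := exists_invSqrtSymbol_eq lam hmu
    (E := E) (h := freeEnergy m k) (by linarith)
  obtain ⟨w, -, hw, -⟩ := exists_invSqrtSymbol_eq lam hmu
    (E := E) (h := omega m p + (freeEnergy m k - omega m (k i))) (by linarith)
  simp only [pairKernel, Function.update_idem, Function.update_eq_self, freeEnergy_update, hv, hw,
    map_mul, map_pow, map_inv₀, map_add, map_sub, Complex.conj_ofReal]
  push_cast
  rw [show (omega m p : ℂ) + (freeEnergy m k - omega m (k i)) - E + omega m (k i) =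
    freeEnergy m k - E + omega m p by ring]
  ring

/-! ### The potential on general states -/

/-- Almost every slice of a state is in L², as is (z + ω)⁻¹. Hence the domain of U(E) is restricted
only by square integrability of the result. -/
theorem ae_integrable_potentialIntegrand {m : ℝ} (hm : 0 < m) {n : ℕ} {E : ℂ}
    (hE : E.re < n * m + m) (ψ : Fock n) :
    ∀ᵐ k ∂nMeasure n, ∀ i, Integrable (potentialIntegrand m E ψ k i) momentumMeasure := by
  refine ae_all_iff.2 fun i => ?_
  have h0 : ∀ᵐ k ∂nMeasure n,
      MemLp (fun p => amp ψ (Function.update k i p)) 2 momentumMeasure :=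
    ae_memLp_update i (measurable_amp ψ) (memLp_amp ψ)
  filter_upwards [h0, ae_le_freeEnergy m n] with k h1 h2
  have h3 := h1.integrable_mul (memLp_inv_add_omega hm (neg_lt_re_freeEnergy_sub hE h2))
  exact h3

theorem ae_potential_comp_perm (m : ℝ) {n : ℕ} (E : ℂ) (ψ : Fock n) (σ : Equiv.Perm (Fin n)) :
    ∀ᵐ k ∂nMeasure n, ∑ i, ∫ p, potentialIntegrand m E ψ (k ∘ σ) i p ∂momentumMeasure =
      ∑ i, ∫ p, potentialIntegrand m E ψ k i p ∂momentumMeasure := by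
  have h : ∀ᵐ k ∂nMeasure n, ∀ i, ∀ᵐ p ∂momentumMeasure,
      amp ψ (Function.update k i p ∘ σ) = amp ψ (Function.update k i p) :=
    ae_all_iff.2 fun i =>
      ae_update i (P := fun k => amp ψ (k ∘ σ) = amp ψ k) (ae_amp_comp_perm ψ σ)
  filter_upwards [h] with k hk
  rw [← Equiv.sum_comp σ fun i => ∫ p, potentialIntegrand m E ψ k i p ∂momentumMeasure]
  refine Finset.sum_congr rfl fun i _ => integral_congr_ae ?_
  filter_upwards [hk (σ i)] with p hp
  rw [potentialIntegrand, potentialIntegrand, freeEnergy_comp_perm, update_comp_perm, hp]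

/-! ### Invertibility of the principal operator at low real energies -/

section

variable {m mu lam : ℝ} {n : ℕ}

theorem threshold_lt {E : ℝ} (hm : 0 < m) (hmu : mu < m) (hE : E < m * ((n : ℝ) - 1) + mu) :
    (E : ℂ).re < n * m + m := by
  rw [Complex.ofReal_re]
  linarith

theorem ae_potential_mul_eq {E : ℂ} {s : ℝ → ℂ} {ψ χ : Fock n}
    (h : amp χ =ᵐ[nMeasure n] fun k => s (freeEnergy m k) * amp ψ k) :
    ∀ᵐ k ∂nMeasure n,
      (lam : ℂ) ^ 2 * ∑ i, ∫ p, potentialIntegrand m E χ k i p ∂momentumMeasure =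
      ∑ i, ∫ p, pairKernel m lam E (fun _ => 1) s i k p * amp ψ (Function.update k i p)
        ∂momentumMeasure := by
  have h1 : ∀ᵐ k ∂nMeasure n, ∀ i, ∀ᵐ p ∂momentumMeasure, amp χ (Function.update k i p) =
      s (freeEnergy m (Function.update k i p)) * amp ψ (Function.update k i p) :=
    ae_all_iff.2 fun i =>
      ae_update i (P := fun k => amp χ k = s (freeEnergy m k) * amp ψ k) h
  filter_upwards [h1] with k hk
  rw [Finset.mul_sum]
  refine Finset.sum_congr rfl fun i _ => ?_
  rw [← integral_const_mul]
  refine integral_congr_ae ?_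
  filter_upwards [hk i] with p hp
  rw [potentialIntegrand, pairKernel, hp]
  ring

/-- The range of K(E)^{-1/2} lies in the domain of U(E), so U(E) K(E)^{-1/2} is everywhere defined
and bounded. -/
theorem exists_clm_potential_mul (hm : 0 < m) (hmu : mu < m) {E : ℝ}
    (hE : E < m * ((n : ℝ) - 1) + mu) {S : Fock n →L[ℂ] Fock n}
    (hS : ∀ x y, (x, y) ∈ (kineticInvSqrt m mu lam n E).graph ↔ S x = y) :
    ∃ V : Fock n →L[ℂ] Fock n, ∀ x y, (S x, y) ∈ (potentialOp m lam n E).graph ↔ V x = y := by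
  obtain ⟨C, hC⟩ := isHSKernel_potential_mul (n := n) lam hm hmu hE
  have hSamp : ∀ ψ, amp (S ψ) =ᵐ[nMeasure n]
      fun k => invSqrtSymbol m mu lam E (freeEnergy m k) * amp ψ k := fun ψ =>
    (mem_graph_funH0 _ _ _ _ _).1 ((hS ψ _).2 rfl)
  have hiff : ∀ x y, (S x, y) ∈ (potentialOp m lam n E).graph ↔
      amp y =ᵐ[nMeasure n] fun k => ∑ i, ∫ p, pairKernel m lam E (fun _ => 1)
        (invSqrtSymbol m mu lam E) i k p * amp x (Function.update k i p) ∂momentumMeasure := by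
    intro x y
    rw [mem_graph_potentialOp, and_iff_right
      (ae_integrable_potentialIntegrand hm (threshold_lt hm hmu hE) _)]
    have h := ae_potential_mul_eq (lam := lam) (hSamp x) (E := E)
    exact ⟨fun h1 => h1.trans h, fun h1 => h1.trans (Filter.EventuallyEq.symm h)⟩
  have hbound := IsHSKernel.sum_lintegral_le hC
  obtain ⟨V, -, hV⟩ := exists_clm_of_rel
    (fun x y => (S x, y) ∈ (potentialOp m lam n E).graph) ((n : NNReal) * C : NNReal)
    (NNReal.coe_nonneg _)
    (fun x y x' y' h h' => by
      simp only [map_add]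
      exact (potentialOp m lam n E).graph.add_mem h h')
    (fun c x y h => by
      simp only [map_smul]
      exact (potentialOp m lam n E).graph.smul_mem c h)
    (fun ψ => by
      obtain ⟨χ, hχ⟩ := exists_amp_eq (f := fun k => ∑ i, ∫ p, pairKernel m lam E (fun _ => 1)
        (invSqrtSymbol m mu lam E) i k p * amp ψ (Function.update k i p) ∂momentumMeasure)
        (memLp_finsetSum _ fun i _ => by
          have h := hC i
          rw [← ENNReal.coe_pow] at h
          exact h.memLp ψ)
        (fun σ => by
          have h1 := ae_potential_mul_eq (lam := lam) (hSamp ψ) (E := E)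
          filter_upwards [h1, (measurePreserving_perm n σ).quasiMeasurePreserving.ae h1,
            ae_potential_comp_perm m (E : ℂ) (S ψ) σ] with k a b d
          rw [← a, ← b, d])
      exact ⟨χ, (hiff _ _).2 hχ⟩)
    (fun ψ χ h => by
      refine norm_le_of_lintegral_le ((hiff _ _).1 h) ?_
      push_cast
      exact hbound ψ)
  exact ⟨V, hV⟩

/-- The bounded operators `S = K(E)^{-1/2}` and `V = U(E) S`, for which `S V` is a symmetric
contraction. -/
theorem exists_relative_operators (hm : 0 < m) (hmu : mu < m) {E : ℝ}
    (hE : E < m * ((n : ℝ) - 1) + mu) :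
    ∃ S V : Fock n →L[ℂ] Fock n,
      (∀ x y, (x, y) ∈ (kineticInvSqrt m mu lam n E).graph ↔ S x = y) ∧
      (∀ x y, (S x, y) ∈ (potentialOp m lam n E).graph ↔ V x = y) ∧
      (∀ x y, (x, y) ∈ (kineticOp m mu lam n E).graph ↔ S (S y) = x) ∧
      ‖S ∘L V‖ ≤ n * (lam ^ 2 / (4 * Real.pi * (m * ((n : ℝ) - 1) + mu - E))) ∧
      (∀ φ ψ, inner ℂ (S φ) ψ = inner ℂ φ (S ψ)) ∧
      (∀ φ ψ, inner ℂ (S (V φ)) ψ = inner ℂ φ (S (V ψ))) := by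
  set s := invSqrtSymbol m mu lam E with hs
  have hc0 : 0 < m * ((n : ℝ) - 1) + mu - E := by linarith
  have hpos : ∀ h : ℝ, n * m ≤ h → m ≤ h - E + mu := fun h hh => by linarith
  have hsy : ∀ h : ℝ, n * m ≤ h → ∃ y : ℝ, 0 < y ∧ s h = y ∧ y ^ 2 ≤ (h - E + mu)⁻¹ ∧
      kineticSymbol m mu lam E h * (y * y) = 1 := fun h hh =>
    exists_invSqrtSymbol_eq lam hmu (hm.trans_le (hpos h hh))
  -- On the spectrum of H₀ one has h - E + μ_p ≥ m, so the symbol is at most m^{-1/2}.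
  obtain ⟨S, -, hS⟩ := exists_clm_funH0 m n (measurable_invSqrtSymbol m mu lam E)
    (C := Real.sqrt m⁻¹) (Real.sqrt_nonneg _) fun h hh => by
      obtain ⟨y, hy0, hy, hy2, -⟩ := hsy h hh
      rw [← hs, hy, Complex.norm_real, Real.norm_eq_abs, abs_of_pos hy0]
      exact Real.le_sqrt_of_sq_le (hy2.trans (inv_anti₀ hm (hpos h hh)))
  obtain ⟨V, hV⟩ := exists_clm_potential_mul (n := n) hm hmu hE hS
  have hSamp : ∀ ψ, amp (S ψ) =ᵐ[nMeasure n] fun k => s (freeEnergy m k) * amp ψ k := fun ψ =>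
    (mem_graph_funH0 _ _ _ _ _).1 ((hS ψ _).2 rfl)
  have hT : ∀ ψ, amp (S (V ψ)) =ᵐ[nMeasure n] fun k => ∑ i, ∫ p, pairKernel m lam E s s i k p *
      amp ψ (Function.update k i p) ∂momentumMeasure := by
    intro ψ
    filter_upwards [hSamp (V ψ), ((mem_graph_potentialOp _ _ _ _ _ _).1 ((hV ψ _).2 rfl)).2,
      ae_potential_mul_eq (lam := lam) (hSamp ψ) (E := E)] with k h1 h2 h3
    rw [h1, h2, h3, Finset.mul_sum]
    refine Finset.sum_congr rfl fun i _ => ?_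
    rw [← integral_const_mul]
    refine integral_congr_ae (ae_of_all _ fun p => ?_)
    simp only [pairKernel]
    ring
  have hHS := isHSKernel_relative (n := n) lam hm hmu hE
  have hHS' : ∀ i : Fin n, IsHSKernel i (pairKernel m lam E s s i)
      ((Real.toNNReal (lam ^ 2 / (4 * Real.pi * (m * ((n : ℝ) - 1) + mu - E))) ^ 2 : NNReal) :
        ENNReal) := by
    intro i
    rw [ENNReal.coe_pow]
    exact hHS i
  refine ⟨S, V, hS, hV, fun x y => ?_, ?_, fun φ ψ => ?_, fun φ ψ => ?_⟩
  · rw [kineticOp, mem_graph_funH0]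
    constructor
    · intro h
      refine amp_ext ?_
      filter_upwards [h, hSamp y, hSamp (S y), ae_le_freeEnergy m n] with k a b c d
      obtain ⟨v, -, hv, -, hv2⟩ := hsy _ d
      rw [c, b, a, hv]
      linear_combination amp x k * hv2
    · rintro rfl
      filter_upwards [hSamp y, hSamp (S y), ae_le_freeEnergy m n] with k b c d
      obtain ⟨v, -, hv, -, hv2⟩ := hsy _ d
      rw [c, b, hv]
      linear_combination -amp y k * hv2
  · refine ContinuousLinearMap.opNorm_le_bound _ (by positivity) fun ψ => ?_
    have h1 := norm_le_of_lintegral_le (ψ := ψ)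
      (C := n * Real.toNNReal (lam ^ 2 / (4 * Real.pi * (m * ((n : ℝ) - 1) + mu - E))))
      (hT ψ) (by push_cast; exact IsHSKernel.sum_lintegral_le hHS ψ)
    rwa [NNReal.coe_mul, Real.coe_toNNReal _ (by positivity)] at h1
  · rw [inner_eq_integral, inner_eq_integral]
    refine integral_congr_ae ?_
    filter_upwards [hSamp φ, hSamp ψ, ae_le_freeEnergy m n] with k a b d
    obtain ⟨v, -, hv, -⟩ := hsy _ d
    rw [a, b, hv, map_mul, Complex.conj_ofReal]
    ring
  · rw [inner_eq_integral, inner_eq_integral]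
    have h1 : ∫ k, amp ψ k * (starRingEnd ℂ) (amp (S (V φ)) k) ∂nMeasure n =
        ∑ i, ∫ k, amp ψ k * (starRingEnd ℂ) (∫ p, pairKernel m lam E s s i k p *
          amp φ (Function.update k i p) ∂momentumMeasure) ∂nMeasure n := by
      rw [← integral_finsetSum _ fun i _ => integrable_mul_conj (memLp_amp ψ) ((hHS' i).memLp φ)]
      refine integral_congr_ae ?_
      filter_upwards [hT φ] with k hk
      rw [hk, map_sum, Finset.mul_sum]
    have h2 : ∫ k, amp (S (V ψ)) k * (starRingEnd ℂ) (amp φ k) ∂nMeasure n =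
        ∑ i, ∫ k, (∫ p, pairKernel m lam E s s i k p *
          amp ψ (Function.update k i p) ∂momentumMeasure) *
            (starRingEnd ℂ) (amp φ k) ∂nMeasure n := by
      rw [← integral_finsetSum _ fun i _ => integrable_mul_conj ((hHS' i).memLp ψ) (memLp_amp φ)]
      refine integral_congr_ae ?_
      filter_upwards [hT ψ] with k hk
      rw [hk, Finset.sum_mul]
    rw [h1, h2]
    exact Finset.sum_congr rfl fun i _ => ((hHS' i).integral_symm
      (fun k hk p hp => conj_relativeKernel lam hmu hE i hk hp hm) φ ψ).symm

/-- The hypothesis has room to spare: 1/(4π) ≤ π/2. -/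
theorem relative_bound_lt_one {E : ℝ} (hE : E < m * ((n : ℝ) - 1) + mu)
    (hlt : lam ^ 2 * Real.pi * n / (2 * (m * ((n : ℝ) - 1) + mu - E)) < 1) :
    n * (lam ^ 2 / (4 * Real.pi * (m * ((n : ℝ) - 1) + mu - E))) < 1 := by
  have hc0 : 0 < m * ((n : ℝ) - 1) + mu - E := by linarith
  refine lt_of_le_of_lt ?_ hlt
  have hpi := Real.pi_gt_three
  rw [mul_div_assoc', div_le_div_iff₀ (by positivity) (by positivity)]
  have h1 : (1 : ℝ) ≤ Real.pi * Real.pi := by nlinarith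
  have h2 : 0 ≤ lam ^ 2 * n * (m * ((n : ℝ) - 1) + mu - E) := by positivity
  nlinarith [mul_le_mul_of_nonneg_left h1 h2]

/-- At low real energies the relative potential is a contraction and the principal operator has a
symmetric bounded inverse. -/
theorem exists_principal_inverse (hm : 0 < m) (hmu : mu < m) {E : ℝ}
    (hE : E < m * ((n : ℝ) - 1) + mu)
    (hlt : lam ^ 2 * Real.pi * n / (2 * (m * ((n : ℝ) - 1) + mu - E)) < 1) :
    (∃ T : Fock n →L[ℂ] Fock n, relativePotential m mu lam n E =
      (T : Fock n →ₗ[ℂ] Fock n).toPMap ⊤ ∧ ‖T‖ < 1) ∧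
    ∃ Φinv : Fock n →L[ℂ] Fock n, HasBoundedInverse (principalOp m mu lam n E) Φinv ∧
      ∀ φ ψ, inner ℂ (Φinv φ) ψ = inner ℂ φ (Φinv ψ) := by
  obtain ⟨S, V, hS, hV, hK, hnorm, hSs, hTs⟩ :=
    exists_relative_operators (n := n) (lam := lam) hm hmu hE
  have hT1 : ‖S ∘L V‖ < 1 := hnorm.trans_lt (relative_bound_lt_one hE hlt)
  refine ⟨⟨S ∘L V, ?_, hT1⟩, ?_⟩
  · refine LinearPMap.eq_of_eq_graph ?_
    ext ⟨x, z⟩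
    rw [relativePotential, mem_graph_pcomp]
    have : ((x, z) ∈ (((S ∘L V : Fock n →L[ℂ] Fock n) : Fock n →ₗ[ℂ] Fock n).toPMap ⊤).graph) ↔
        S (V x) = z := by
      rw [LinearPMap.mem_graph_iff]
      constructor
      · rintro ⟨y, rfl, h⟩
        exact h
      · intro h
        exact ⟨⟨x, trivial⟩, rfl, h⟩
    rw [this]
    constructor
    · rintro ⟨y, h1, h2⟩
      obtain ⟨w, h3, h4⟩ := (mem_graph_pcomp _ _ _ _).1 h1
      rw [hS] at h2 h3
      rw [← h3, hV] at h4
      rw [h4, h2]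
    · intro h
      exact ⟨V x, (mem_graph_pcomp _ _ _ _).2 ⟨S x, (hS _ _).2 rfl, (hV _ _).2 rfl⟩,
        (hS _ _).2 h⟩
  -- `G` is the Neumann inverse of 1 - SV, and Φ⁻¹ = S G S because K = S⁻² and U S = V.
  · let u := Units.oneSub (S ∘L V) hT1
    let G : Fock n →L[ℂ] Fock n := (u⁻¹ : (Fock n →L[ℂ] Fock n)ˣ)
    have hG1 : ∀ x, G (x - S (V x)) = x := fun x => by
      have := congrArg (fun A : Fock n →L[ℂ] Fock n => A x) u.inv_mul
      simpa [u, G] using this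
    have hG2 : ∀ x, G x - S (V (G x)) = x := fun x => by
      have := congrArg (fun A : Fock n →L[ℂ] Fock n => A x) u.mul_inv
      simpa [u, G] using this
    refine ⟨S ∘L G ∘L S, fun x y => ?_, fun φ ψ => ?_⟩
    · rw [principalOp, mem_graph_sub]
      simp only [ContinuousLinearMap.comp_apply]
      constructor
      · rintro ⟨a, b, h1, h2, rfl⟩
        rw [hK] at h1
        rw [← h1, hV] at h2
        rw [← h2, map_sub, hG1, h1]
      · intro h
        have h1 := hG2 (S y)
        -- The fixed-point equation for `G` places G(S y) in the range of S, hence S(G(S y)) in the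
        -- range of S², the domain of K.
        have h2 : G (S y) = S (y + V (G (S y))) := by
          rw [map_add, ← sub_eq_iff_eq_add, h1]
        refine ⟨y + V (G (S y)), V (G (S y)), ?_, ?_, by abel⟩
        · rw [hK, ← h2, h]
        · rw [← h, hV]
    · simp only [ContinuousLinearMap.comp_apply]
      rw [hSs, ← hSs φ]
      -- The inverse of the symmetric operator 1 - SV is symmetric.
      have h : ∀ a b, inner ℂ (G a) b = inner ℂ a (G b) := by
        intro a b
        conv_lhs => rw [← hG2 b]
        conv_rhs => rw [← hG2 a]
        rw [inner_sub_left, inner_sub_right, hTs]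
      exact h _ _

end

/-! ### The bounded operators `a⁻¹`, `b a⁻¹` and `a⁻¹ b†` -/

/-- Deleting the `i`-th entry after permuting is deleting the `σ i`-th entry and permuting the rest;
hence a⁻¹b† preserves bosonic symmetry. -/
theorem exists_comp_perm_removeNth {n : ℕ} (σ : Equiv.Perm (Fin (n + 1))) (i : Fin (n + 1)) :
    ∃ τ : Equiv.Perm (Fin n), ∀ k : Fin (n + 1) → ℝ × ℝ,
      i.removeNth (k ∘ σ) = (σ i).removeNth k ∘ τ := by
  let e : {x // x ≠ i} ≃ {x // x ≠ σ i} := σ.subtypeEquiv fun a => by simp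
  refine ⟨((finSuccAboveEquiv i).trans e).trans (finSuccAboveEquiv (σ i)).symm,
    fun k => ?_⟩
  ext1 j
  have h := (finSuccAboveEquiv (σ i)).apply_symm_apply (e (finSuccAboveEquiv i j))
  have h' := congrArg Subtype.val h
  simp only [Fin.removeNth, Function.comp_apply, Equiv.trans_apply]
  exact (congrArg k h').symm

theorem exists_cons_comp_perm {n : ℕ} (σ : Equiv.Perm (Fin n)) :
    ∃ τ : Equiv.Perm (Fin (n + 1)), ∀ (p : ℝ × ℝ) (k : Fin n → ℝ × ℝ),
      (Fin.cons p (k ∘ σ) : Fin (n + 1) → ℝ × ℝ) = (Fin.cons p k : Fin (n + 1) → ℝ × ℝ) ∘ τ := by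
  refine ⟨Equiv.Perm.decomposeFin.symm (0, σ), fun p k => ?_⟩
  ext1 j
  refine Fin.cases ?_ (fun j => ?_) j
  · simp
  · simp

/-- A cyclic permutation moves the inserted momentum to the front, and `f` is symmetric. -/
theorem ae_amp_insertNth_eq_cons {n : ℕ} (f : Fock (n + 1)) (i : Fin (n + 1)) :
    ∀ᵐ r ∂nMeasure n, ∀ᵐ p ∂momentumMeasure,
      amp f (i.insertNth p r) = amp f (Fin.cons p r) := by
  have h := ae_insertNth i (P := fun k => amp f (k ∘ i.cycleRange.symm) = amp f k)
    (ae_amp_comp_perm f i.cycleRange.symm)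
  filter_upwards [h] with r hr
  filter_upwards [hr] with p hp
  rw [Fin.insertNth_comp_cycleRange_symm] at hp
  exact hp.symm

section

variable {m lam : ℝ} {n : ℕ}

theorem neg_lt_re {E : ℂ} (hE : E.re < n * m + m) {k : Fin n → ℝ × ℝ}
    (hk : n * m ≤ freeEnergy m k) : -m < ((freeEnergy m k : ℂ) - E).re :=
  neg_lt_re_freeEnergy_sub hE hk

theorem exists_clm_aInv {E : ℂ} (hE : E.re < n * m + m) :
    ∃ A : Fock (n + 1) →L[ℂ] Fock (n + 1), ∀ x y,
      (x, y) ∈ (funH0 m (n + 1) fun h => ((h : ℂ) - E)⁻¹).graph ↔ A x = y := by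
  have hd : 0 < n * m + m - E.re := by linarith
  obtain ⟨A, -, hA⟩ := exists_clm_funH0 m (n + 1) (s := fun h => ((h : ℂ) - E)⁻¹) (by fun_prop)
    (C := (n * m + m - E.re)⁻¹) (by positivity) fun h hh => by
      rw [norm_inv]
      refine inv_anti₀ hd ?_
      refine le_trans ?_ (Complex.re_le_norm _)
      push_cast at hh
      simp only [Complex.sub_re, Complex.ofReal_re]
      linarith
  exact ⟨A, hA⟩

theorem exists_lintegral_resolvent_le (hm : 0 < m) {E : ℂ} (hE : E.re < n * m + m) :
    ∃ C : NNReal, ∀ h : ℝ, n * m ≤ h →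
      ∫⁻ p, ‖((h : ℂ) - E + omega m p)⁻¹‖ₑ ^ 2 ∂momentumMeasure ≤ C := by
  obtain ⟨C, hC⟩ := exists_lintegral_inv_sq_le hm (d := n * m + m - E.re) (by linarith)
  refine ⟨C, fun h hh => hC _ ?_⟩
  simp only [Complex.sub_re, Complex.ofReal_re]
  linarith

/-- One term of `a⁻¹ b†`. -/
theorem lintegral_removeNth_le {E : ℂ} {C : NNReal} (hC : ∀ h : ℝ, n * m ≤ h →
      ∫⁻ p, ‖((h : ℂ) - E + omega m p)⁻¹‖ₑ ^ 2 ∂momentumMeasure ≤ C) (g : Fock n)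
    (i : Fin (n + 1)) :
    ∫⁻ k, ‖((freeEnergy m k : ℂ) - E)⁻¹ * amp g (i.removeNth k)‖ₑ ^ 2 ∂nMeasure (n + 1) ≤
      C * ∫⁻ k, ‖amp g k‖ₑ ^ 2 ∂nMeasure n := by
  have hg := measurable_amp g
  have hmeas := measurable_omega m
  have hrem : Measurable fun k : Fin (n + 1) → ℝ × ℝ => i.removeNth k :=
    measurable_pi_lambda _ fun j => measurable_pi_apply _
  have hfe := measurable_freeEnergy m (n + 1)
  have hg2 := hg.comp hrem
  simp only [Function.comp_def] at hg2
  rw [lintegral_insertNth i (by fun_prop), ← lintegral_const_mul _ (by fun_prop)]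
  refine lintegral_mono_ae ?_
  filter_upwards [ae_le_freeEnergy m n] with r hr
  simp only [enorm_mul, mul_pow, Fin.removeNth_insertNth, freeEnergy_insertNth]
  rw [lintegral_mul_const _ (by fun_prop)]
  gcongr
  refine le_trans (le_of_eq ?_) (hC _ hr)
  refine lintegral_congr fun p => ?_
  congr 3
  push_cast
  ring

theorem memLp_removeNth {E : ℂ} (hm : 0 < m) (hE : E.re < n * m + m) (g : Fock n)
    (i : Fin (n + 1)) :
    MemLp (fun k => ((freeEnergy m k : ℂ) - E)⁻¹ * amp g (i.removeNth k)) 2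
      (nMeasure (n + 1)) := by
  obtain ⟨C, hC⟩ := exists_lintegral_resolvent_le hm hE
  refine memLp_two_of_lintegral_lt_top ?_ ((lintegral_removeNth_le hC g i).trans_lt
    (ENNReal.mul_lt_top (by simp) (MemLp.lintegral_sq_lt_top (memLp_amp g))))
  have hrem : Measurable fun k : Fin (n + 1) → ℝ × ℝ => i.removeNth k :=
    measurable_pi_lambda _ fun j => measurable_pi_apply _
  have hfe := measurable_freeEnergy m (n + 1)
  have hg2 := (measurable_amp g).comp hrem
  simp only [Function.comp_def] at hg2
  exact Measurable.aestronglyMeasurable (by fun_prop)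

theorem exists_clm_aInvBdag (hm : 0 < m) {E : ℂ} (hE : E.re < n * m + m) :
    ∃ T : Fock n →L[ℂ] Fock (n + 1), ∀ g u, IsAInvBdag m lam n E g u ↔ T g = u := by
  obtain ⟨C, hC⟩ := exists_lintegral_resolvent_le hm hE
  set c : ℂ := (lam : ℂ) * (((Real.sqrt (n + 1))⁻¹ : ℝ) : ℂ) with hc
  have hform : ∀ (g : Fock n) (k : Fin (n + 1) → ℝ × ℝ), ((freeEnergy m k : ℂ) - E)⁻¹ *
      (c * ∑ i : Fin (n + 1), amp g (i.removeNth k)) =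
      ∑ i : Fin (n + 1), c * (((freeEnergy m k : ℂ) - E)⁻¹ * amp g (i.removeNth k)) := by
    intro g k
    rw [mul_left_comm, ← Finset.mul_sum, ← Finset.mul_sum]
  have hmem : ∀ (g : Fock n) (i : Fin (n + 1)), MemLp (fun k => c *
      (((freeEnergy m k : ℂ) - E)⁻¹ * amp g (i.removeNth k))) 2 (nMeasure (n + 1)) :=
    fun g i => (memLp_removeNth hm hE g i).const_mul c
  have hbound : ∀ g : Fock n, ∫⁻ k, ‖((freeEnergy m k : ℂ) - E)⁻¹ *
      (c * ∑ i : Fin (n + 1), amp g (i.removeNth k))‖ₑ ^ 2 ∂nMeasure (n + 1) ≤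
      ((((n + 1 : ℕ) : NNReal) * (‖c‖₊ * NNReal.sqrt C) : NNReal) : ENNReal) ^ 2 *
        ∫⁻ k, ‖amp g k‖ₑ ^ 2 ∂nMeasure n := by
    intro g
    simp only [hform]
    rw [← enorm_sq_eq_lintegral]
    rw [ENNReal.coe_mul, ENNReal.coe_natCast]
    refine lintegral_sum_sq_le (fun i => (hmem g i).1) fun i => ?_
    rw [enorm_sq_eq_lintegral, ENNReal.coe_mul, mul_pow, ← ENNReal.coe_pow (NNReal.sqrt C),
      NNReal.sq_sqrt, mul_assoc]
    simp only [enorm_mul c, mul_pow (‖c‖ₑ)]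
    rw [lintegral_const_mul' _ _ (by simp)]
    gcongr
    · exact le_rfl
    · exact lintegral_removeNth_le hC g i
  obtain ⟨T, -, hT⟩ := exists_clm_of_rel (IsAInvBdag m lam n E) _ (NNReal.coe_nonneg _)
    (fun g u g' u' h h' => by
      have h1 : ∀ᵐ k ∂nMeasure (n + 1), ∀ i : Fin (n + 1), amp (g + g') (i.removeNth k) =
          amp g (i.removeNth k) + amp g' (i.removeNth k) :=
        ae_all_iff.2 fun i => ae_removeNth i (P := fun k => amp (g + g') k = amp g k + amp g' k)
          (amp_add g g')
      filter_upwards [h, h', amp_add u u', h1] with k a b d e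
      rw [d, Pi.add_apply, a, b, Finset.sum_congr rfl fun i _ => e i, Finset.sum_add_distrib]
      ring)
    (fun z g u h => by
      have h1 : ∀ᵐ k ∂nMeasure (n + 1), ∀ i : Fin (n + 1), amp (z • g) (i.removeNth k) =
          z * amp g (i.removeNth k) :=
        ae_all_iff.2 fun i => ae_removeNth i (P := fun k => amp (z • g) k = z * amp g k)
          (amp_smul z g)
      filter_upwards [h, amp_smul z u, h1] with k a d e
      rw [d, Pi.smul_apply, a, Finset.sum_congr rfl fun i _ => e i, ← Finset.mul_sum, smul_eq_mul]
      ring)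
    (fun g => by
      refine exists_amp_eq (f := fun k => ((freeEnergy m k : ℂ) - E)⁻¹ *
        (c * ∑ i : Fin (n + 1), amp g (i.removeNth k))) ?_ fun σ => ?_
      · simp only [hform]
        exact memLp_finsetSum _ fun i _ => hmem g i
      · have h1 : ∀ᵐ k ∂nMeasure (n + 1), ∀ i : Fin (n + 1),
            amp g (i.removeNth (k ∘ σ)) = amp g ((σ i).removeNth k) := by
          refine ae_all_iff.2 fun i => ?_
          obtain ⟨τ, hτ⟩ := exists_comp_perm_removeNth σ i
          filter_upwards [ae_removeNth (σ i) (P := fun k => amp g (k ∘ τ) = amp g k)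
            (ae_amp_comp_perm g τ)] with k hk
          rw [hτ, hk]
        filter_upwards [h1] with k hk
        rw [freeEnergy_comp_perm, Finset.sum_congr rfl fun i _ => hk i,
          Equiv.sum_comp σ fun i => amp g (i.removeNth k)])
    (fun g u h => norm_le_of_lintegral_le h (hbound g))
  exact ⟨T, hT⟩

theorem freeEnergy_cons_sub (E : ℂ) (p : ℝ × ℝ) (k : Fin n → ℝ × ℝ) :
    (freeEnergy m (Fin.cons p k : Fin (n + 1) → ℝ × ℝ) : ℂ) - E =
      (freeEnergy m k : ℂ) - E + omega m p := by
  rw [freeEnergy_cons]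
  push_cast
  ring

theorem ae_integrable_baInv (hm : 0 < m) {E : ℂ} (hE : E.re < n * m + m) (f : Fock (n + 1)) :
    ∀ᵐ k ∂nMeasure n, Integrable (fun p : ℝ × ℝ => amp f (Fin.cons p k) /
      ((freeEnergy m (Fin.cons p k : Fin (n + 1) → ℝ × ℝ) : ℂ) - E)) momentumMeasure := by
  filter_upwards [ae_memLp_cons f, ae_le_freeEnergy m n] with k h1 h2
  have h3 := h1.integrable_mul (memLp_inv_add_omega hm (neg_lt_re hE h2))
  simp only [freeEnergy_cons_sub, div_eq_mul_inv]
  exact h3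

theorem exists_clm_baInv (hm : 0 < m) {E : ℂ} (hE : E.re < n * m + m) :
    ∃ T : Fock (n + 1) →L[ℂ] Fock n, ∀ f w, IsBAInv m lam n E f w ↔ T f = w := by
  obtain ⟨C, hC⟩ := exists_lintegral_resolvent_le hm hE
  set c : ℂ := (lam : ℂ) * ((Real.sqrt (n + 1) : ℝ) : ℂ) with hc
  have hcons : Measurable fun q : (Fin n → ℝ × ℝ) × (ℝ × ℝ) =>
      (Fin.cons q.2 q.1 : Fin (n + 1) → ℝ × ℝ) := by
    have := (measurable_insertNth (n := n) 0).comp measurable_swap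
    simpa [Function.comp_def, Fin.insertNth_zero'] using this
  have hfe := (measurable_freeEnergy m (n + 1)).comp hcons
  simp only [Function.comp_def] at hfe
  have hmeas : ∀ f : Fock (n + 1), Measurable fun k : Fin n → ℝ × ℝ =>
      c * ∫ p : ℝ × ℝ, amp f (Fin.cons p k) /
        ((freeEnergy m (Fin.cons p k : Fin (n + 1) → ℝ × ℝ) : ℂ) - E) ∂momentumMeasure := by
    intro f
    have hf := (measurable_amp f).comp hcons
    simp only [Function.comp_def] at hf
    have : StronglyMeasurable fun k : Fin n → ℝ × ℝ => ∫ p : ℝ × ℝ, amp f (Fin.cons p k) /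
        ((freeEnergy m (Fin.cons p k : Fin (n + 1) → ℝ × ℝ) : ℂ) - E) ∂momentumMeasure := by
      refine StronglyMeasurable.integral_prod_right (f := fun (k : Fin n → ℝ × ℝ) p =>
        amp f (Fin.cons p k) /
        ((freeEnergy m (Fin.cons p k : Fin (n + 1) → ℝ × ℝ) : ℂ) - E))
        (Measurable.stronglyMeasurable ?_)
      unfold Function.uncurry
      fun_prop
    exact this.measurable.const_mul c
  have hbound : ∀ f : Fock (n + 1), ∫⁻ k : Fin n → ℝ × ℝ, ‖c * ∫ p : ℝ × ℝ,
      amp f (Fin.cons p k) / ((freeEnergy m (Fin.cons p k : Fin (n + 1) → ℝ × ℝ) : ℂ) - E)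
        ∂momentumMeasure‖ₑ ^ 2 ∂nMeasure n ≤
      ((‖c‖₊ * NNReal.sqrt C : NNReal) : ENNReal) ^ 2 *
        ∫⁻ k, ‖amp f k‖ₑ ^ 2 ∂nMeasure (n + 1) := by
    intro f
    have hf := measurable_amp f
    have hf2 : Measurable fun k => ‖amp f k‖ₑ ^ 2 := by fun_prop
    have hf3 : Measurable fun r : Fin n → ℝ × ℝ =>
        ∫⁻ p, ‖amp f (Fin.cons p r)‖ₑ ^ 2 ∂momentumMeasure :=
      (hf2.comp hcons).lintegral_prod_right'
    rw [lintegral_insertNth 0 hf2]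
    simp only [Fin.insertNth_zero']
    rw [← lintegral_const_mul _ hf3]
    refine lintegral_mono_ae ?_
    filter_upwards [ae_memLp_cons f, ae_le_freeEnergy m n] with k h1 h2
    simp only [freeEnergy_cons_sub, div_eq_mul_inv]
    rw [enorm_mul, mul_pow, ENNReal.coe_mul, mul_pow, ← ENNReal.coe_pow (NNReal.sqrt C),
      NNReal.sq_sqrt, mul_assoc]
    gcongr
    · exact le_rfl
    · rw [mul_comm (C : ENNReal)]
      refine (enorm_integral_mul_sq_le h1.1
        (memLp_inv_add_omega hm (neg_lt_re hE h2)).1).trans ?_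
      gcongr
      exact hC _ h2
  have hiff : ∀ f w, IsBAInv m lam n E f w ↔ amp w =ᵐ[nMeasure n] fun k => c * ∫ p : ℝ × ℝ,
      amp f (Fin.cons p k) / ((freeEnergy m (Fin.cons p k : Fin (n + 1) → ℝ × ℝ) : ℂ) - E)
      ∂momentumMeasure := fun f w => and_iff_right (ae_integrable_baInv hm hE f)
  obtain ⟨T, -, hT⟩ := exists_clm_of_rel (IsBAInv m lam n E) _ (NNReal.coe_nonneg _)
    (fun f w f' w' h h' => by
      rw [hiff] at h h' ⊢
      filter_upwards [h, h', amp_add w w', ae_cons (P := fun k => amp (f + f') k =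
        amp f k + amp f' k) (amp_add f f'), ae_integrable_baInv hm hE f,
        ae_integrable_baInv hm hE f'] with k a b d e i1 i2
      rw [d, Pi.add_apply, a, b, ← mul_add, ← integral_add i1 i2]
      congr 1
      refine integral_congr_ae ?_
      filter_upwards [e] with p hp
      rw [hp, add_div])
    (fun z f w h => by
      rw [hiff] at h ⊢
      filter_upwards [h, amp_smul z w, ae_cons (P := fun k => amp (z • f) k =
        z * amp f k) (amp_smul z f)] with k a d e
      rw [d, Pi.smul_apply, a, smul_eq_mul, mul_left_comm, ← integral_const_mul]
      congr 1
      refine integral_congr_ae ?_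
      filter_upwards [e] with p hp
      rw [hp, mul_div_assoc])
    (fun f => by
      simp only [hiff]
      refine exists_amp_eq (memLp_two_of_lintegral_lt_top (hmeas f).aestronglyMeasurable
        ((hbound f).trans_lt (ENNReal.mul_lt_top (ENNReal.pow_lt_top ENNReal.coe_lt_top)
          (MemLp.lintegral_sq_lt_top (memLp_amp f))))) fun σ => ?_
      obtain ⟨τ, hτ⟩ := exists_cons_comp_perm σ
      filter_upwards [ae_cons (P := fun k => amp f (k ∘ τ) = amp f k) (ae_amp_comp_perm f τ)]
        with k hk
      congr 1
      refine integral_congr_ae ?_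
      filter_upwards [hk] with p hp
      rw [hτ, freeEnergy_comp_perm, hp])
    (fun f w h => norm_le_of_lintegral_le ((hiff f w).1 h) (hbound f))
  exact ⟨T, hT⟩

/-- `(b a⁻¹)* = a⁻¹ b†` at real energies. -/
theorem inner_baInv_eq (hm : 0 < m) {E : ℝ} (hE : (E : ℂ).re < n * m + m)
    {f : Fock (n + 1)} {w : Fock n} (hw : IsBAInv m lam n E f w)
    {g : Fock n} {u : Fock (n + 1)} (hu : IsAInvBdag m lam n E g u) :
    inner ℂ w g = inner ℂ f u := by
  rw [inner_eq_integral, inner_eq_integral]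
  set c : ℂ := (lam : ℂ) * (((Real.sqrt (n + 1))⁻¹ : ℝ) : ℂ) with hc
  have hint : ∀ i : Fin (n + 1), Integrable (fun k => ((freeEnergy m k : ℂ) - E)⁻¹ *
      amp g (i.removeNth k) * (starRingEnd ℂ) (amp f k)) (nMeasure (n + 1)) := fun i =>
    integrable_mul_conj (memLp_removeNth hm hE g i) (memLp_amp f)
  have h1 : ∫ k, amp u k * (starRingEnd ℂ) (amp f k) ∂nMeasure (n + 1) =
      c * ∑ i : Fin (n + 1), ∫ k, ((freeEnergy m k : ℂ) - E)⁻¹ * amp g (i.removeNth k) *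
        (starRingEnd ℂ) (amp f k) ∂nMeasure (n + 1) := by
    rw [← integral_finsetSum _ fun i _ => hint i, ← integral_const_mul]
    refine integral_congr_ae ?_
    filter_upwards [hu] with k hk
    rw [hk, ← Finset.sum_mul, ← Finset.mul_sum]
    ring
  -- By symmetry of `f` the n + 1 terms of b† contribute equally; (n + 1)/√(n + 1) = √(n + 1) then
  -- matches the normalization of b.
  have h2 : ∀ i : Fin (n + 1), ∫ k, ((freeEnergy m k : ℂ) - E)⁻¹ * amp g (i.removeNth k) *
        (starRingEnd ℂ) (amp f k) ∂nMeasure (n + 1) =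
      ∫ r, amp g r * (starRingEnd ℂ) (∫ p, amp f (Fin.cons p r) /
        ((freeEnergy m (Fin.cons p r : Fin (n + 1) → ℝ × ℝ) : ℂ) - E) ∂momentumMeasure)
          ∂nMeasure n := by
    intro i
    rw [integral_insertNth i (hint i)]
    refine integral_congr_ae ?_
    filter_upwards [ae_amp_insertNth_eq_cons f i] with r hr
    rw [← integral_conj, ← integral_const_mul]
    refine integral_congr_ae ?_
    filter_upwards [hr] with p hp
    rw [hp, Fin.removeNth_insertNth, freeEnergy_insertNth, freeEnergy_cons, map_div₀, map_sub,
      Complex.conj_ofReal, Complex.conj_ofReal]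
    ring
  rw [h1, Finset.sum_congr rfl fun i _ => h2 i, Finset.sum_const, Finset.card_univ,
    Fintype.card_fin, nsmul_eq_mul, ← mul_assoc, ← integral_const_mul]
  refine integral_congr_ae ?_
  filter_upwards [hw.2] with r hr
  rw [hr, map_mul, map_mul, Complex.conj_ofReal, Complex.conj_ofReal]
  have h3 : c * ((n + 1 : ℕ) : ℂ) = (lam : ℂ) * ((Real.sqrt (n + 1) : ℝ) : ℂ) := by
    rw [hc, mul_assoc]
    congr 1
    rw [← Complex.ofReal_natCast, ← Complex.ofReal_mul]
    congr 1
    push_cast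
    rw [inv_mul_eq_div, Real.div_sqrt]
  rw [h3]
  ring

end

/-! ### The dependence of the principal operator on the energy -/

section

variable {m mu lam : ℝ} {n : ℕ}

theorem ne_zero_of_neg_lt_re {z : ℂ} (hz : -m < z.re) {p : ℝ × ℝ} (hp : m ≤ omega m p) :
    z + omega m p ≠ 0 := by
  intro h0
  have := congrArg Complex.re h0
  simp only [Complex.add_re, Complex.ofReal_re, Complex.zero_re] at this
  linarith

/-- The counterterm 1/(ω - μ_p) does not depend on the energy and cancels, leaving the resolvent
identity for (h - E + ω)⁻¹ under the integral. -/
theorem kineticSymbol_sub (hm : 0 < m) (hmu : mu < m) {E F : ℂ} {h : ℝ}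
    (hE : -m < ((h : ℂ) - E).re) (hF : -m < ((h : ℂ) - F).re) :
    kineticSymbol m mu lam E h = kineticSymbol m mu lam F h - (E - F) * (1 + (lam : ℂ) ^ 2 *
      ∫ p, ((h : ℂ) - E + omega m p)⁻¹ * ((h : ℂ) - F + omega m p)⁻¹ ∂momentumMeasure) := by
  have h1 := integral_sub (integrable_kineticSymbol hm hmu hF) (integrable_kineticSymbol hm hmu hE)
  have h2 : ∫ p, ((1 / ((omega m p : ℂ) - mu) - 1 / ((h : ℂ) - F + omega m p)) -
      (1 / ((omega m p : ℂ) - mu) - 1 / ((h : ℂ) - E + omega m p))) ∂momentumMeasure =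
      (E - F) * ∫ p, ((h : ℂ) - E + omega m p)⁻¹ * ((h : ℂ) - F + omega m p)⁻¹
        ∂momentumMeasure := by
    rw [← integral_const_mul]
    refine integral_congr_ae ?_
    filter_upwards [ae_le_omega m] with p hp
    have e1 := ne_zero_of_neg_lt_re hE hp
    have e2 := ne_zero_of_neg_lt_re hF hp
    rw [sub_sub_sub_cancel_left]
    field_simp
    ring
  rw [h2] at h1
  simp only [kineticSymbol]
  linear_combination (lam : ℂ) ^ 2 * h1

/-- `M` is the part of b a(E)⁻¹ a(F)⁻¹ b† in which the created boson is the one annihilated.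
Cauchy–Schwarz bounds its symbol uniformly in h. -/
theorem exists_clm_diagonal (hm : 0 < m) {E F : ℂ} (hE : E.re < n * m + m)
    (hF : F.re < n * m + m) :
    ∃ M : Fock n →L[ℂ] Fock n, ∀ x, amp (M x) =ᵐ[nMeasure n] fun k => (lam : ℂ) ^ 2 *
      (∫ p, ((freeEnergy m k : ℂ) - E + omega m p)⁻¹ * ((freeEnergy m k : ℂ) - F + omega m p)⁻¹
        ∂momentumMeasure) * amp x k := by
  obtain ⟨C, hC⟩ := exists_lintegral_resolvent_le hm hE
  obtain ⟨D, hD⟩ := exists_lintegral_resolvent_le hm hF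
  have hmeas := measurable_omega m
  have hsm : StronglyMeasurable fun h : ℝ => ∫ p, ((h : ℂ) - E + omega m p)⁻¹ *
      ((h : ℂ) - F + omega m p)⁻¹ ∂momentumMeasure := by
    refine StronglyMeasurable.integral_prod_right (f := fun (h : ℝ) p =>
      ((h : ℂ) - E + omega m p)⁻¹ * ((h : ℂ) - F + omega m p)⁻¹)
      (Measurable.stronglyMeasurable ?_)
    unfold Function.uncurry
    fun_prop
  obtain ⟨M, -, hM⟩ := exists_clm_funH0 m n (hsm.measurable.const_mul ((lam : ℂ) ^ 2))
    (C := (‖(lam : ℂ) ^ 2‖₊ * NNReal.sqrt (C * D) : NNReal)) (NNReal.coe_nonneg _) fun h hh => by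
      rw [norm_mul, NNReal.coe_mul]
      refine mul_le_mul_of_nonneg_left ?_ (norm_nonneg _)
      have h1 := (enorm_integral_mul_sq_le
        (memLp_inv_add_omega hm (neg_lt_re_freeEnergy_sub hE hh)).1
        (memLp_inv_add_omega hm (neg_lt_re_freeEnergy_sub hF hh)).1).trans
        (mul_le_mul' (hC h hh) (hD h hh))
      rw [enorm_eq_nnnorm, ← ENNReal.coe_pow, ← ENNReal.coe_mul, ENNReal.coe_le_coe] at h1
      have h2 := NNReal.le_sqrt_iff_sq_le.2 h1
      exact NNReal.coe_le_coe.2 h2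
  exact ⟨M, fun x => (mem_graph_funH0 _ _ _ _ _).1 ((hM x _).2 rfl)⟩

/-- The operator `b a(E)⁻¹ a(F)⁻¹ b†`, split into its diagonal and exchange parts. -/
theorem ae_baInv_aInvBdag (hm : 0 < m) {E F : ℂ} (hE : E.re < n * m + m)
    (hF : F.re < n * m + m) {x w : Fock n} {c : Fock (n + 1)} (hc : IsAInvBdag m lam n F x c)
    (hw : IsBAInv m lam n E c w) :
    ∀ᵐ k ∂nMeasure n, amp w k = (lam : ℂ) ^ 2 *
      (∫ p, ((freeEnergy m k : ℂ) - E + omega m p)⁻¹ * ((freeEnergy m k : ℂ) - F + omega m p)⁻¹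
        ∂momentumMeasure) * amp x k + (lam : ℂ) ^ 2 *
      ∑ j, ∫ p, ((freeEnergy m k : ℂ) - E + omega m p)⁻¹ *
        ((freeEnergy m k : ℂ) - F + omega m p)⁻¹ * amp x (Function.update k j p)
          ∂momentumMeasure := by
  -- Deleting entry 0 of (p, k) returns k, the diagonal term. Deleting entry j + 1 leaves, up to a
  -- permutation, k with its `j`-th momentum replaced by p, the exchange term.
  have hx : ∀ᵐ k ∂nMeasure n, ∀ j, ∀ᵐ p ∂momentumMeasure,
      amp x (j.succ.removeNth (Fin.cons p k : Fin (n + 1) → ℝ × ℝ)) =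
        amp x (Function.update k j p) := by
    refine ae_all_iff.2 fun j => ?_
    cases n with
    | zero => exact j.elim0
    | succ n =>
      have h := ae_update j (P := fun k => amp x (k ∘ j.cycleRange.symm) = amp x k)
        (ae_amp_comp_perm x j.cycleRange.symm)
      filter_upwards [h] with k hk
      filter_upwards [hk] with p hp
      rw [← hp, ← Fin.cons_removeNth_eq_comp_cycleRange_symm, Function.update_self,
        Fin.removeNth_update]
      congr 1
      ext1 i
      refine Fin.cases ?_ (fun i => ?_) i
      · simp [Fin.removeNth]
      · simp [Fin.removeNth]
  have hint : ∀ᵐ k ∂nMeasure n, ∀ j, Integrable (fun p =>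
      ((freeEnergy m k : ℂ) - E + omega m p)⁻¹ *
        ((freeEnergy m k : ℂ) - F + omega m p)⁻¹ * amp x (Function.update k j p))
          momentumMeasure := by
    refine ae_all_iff.2 fun j => ?_
    filter_upwards [ae_integrable_potentialIntegrand hm hE x,
      ae_integrable_potentialIntegrand hm hF x, ae_le_freeEnergy m n] with k h1 h2 h3
    -- For E ≠ F the product of resolvents splits by partial fractions into two potential
    -- integrands; for E = F one resolvent is simply bounded.
    by_cases hEF : E = F
    · subst hEF
      have hb : Integrable (fun p => ((freeEnergy m k : ℂ) - E + omega m p)⁻¹ *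
          potentialIntegrand m E x k j p) momentumMeasure := by
        refine (h1 j).bdd_mul (c := (n * m + m - E.re)⁻¹) ?_ ?_
        · exact (memLp_inv_add_omega hm (neg_lt_re hE h3)).1
        · filter_upwards [ae_le_omega m] with p hp
          rw [norm_inv]
          refine inv_anti₀ (by linarith) (le_trans ?_ (Complex.re_le_norm _))
          simp only [Complex.add_re, Complex.sub_re, Complex.ofReal_re]
          linarith
      refine hb.congr (ae_of_all _ fun p => ?_)
      simp only [potentialIntegrand]
      ring
    · refine (((h1 j).sub (h2 j)).const_mul (E - F)⁻¹).congr ?_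
      filter_upwards [ae_le_omega m] with p hp
      have e1 := ne_zero_of_neg_lt_re (neg_lt_re hE h3) hp
      have e2 := ne_zero_of_neg_lt_re (neg_lt_re hF h3) hp
      have e3 : E - F ≠ 0 := sub_ne_zero.2 hEF
      simp only [potentialIntegrand, Pi.sub_apply]
      field_simp
      ring
  filter_upwards [hw.2, ae_cons (P := fun k => amp c k = _) hc, hx, hint, ae_le_freeEnergy m n]
    with k h1 h2 h3 h4 h5
  have hI := integrable_inv_mul_inv hm (neg_lt_re hE h5) (neg_lt_re hF h5)
  have hs : ((lam : ℂ) * ((Real.sqrt (n + 1) : ℝ) : ℂ)) *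
      ((lam : ℂ) * (((Real.sqrt (n + 1))⁻¹ : ℝ) : ℂ)) = (lam : ℂ) ^ 2 := by
    have h0 : Real.sqrt (n + 1) ≠ 0 := (Real.sqrt_pos.2 (by positivity)).ne'
    have : ((Real.sqrt (n + 1) : ℝ) : ℂ) * (((Real.sqrt (n + 1))⁻¹ : ℝ) : ℂ) = 1 := by
      rw [← Complex.ofReal_mul, mul_inv_cancel₀ h0, Complex.ofReal_one]
    linear_combination (lam : ℂ) ^ 2 * this
  have hval : ∫ p : ℝ × ℝ, amp c (Fin.cons p k) /
      ((freeEnergy m (Fin.cons p k : Fin (n + 1) → ℝ × ℝ) : ℂ) - E) ∂momentumMeasure =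
      ∫ p, ((lam : ℂ) * (((Real.sqrt (n + 1))⁻¹ : ℝ) : ℂ)) *
        ((((freeEnergy m k : ℂ) - E + omega m p)⁻¹ *
          ((freeEnergy m k : ℂ) - F + omega m p)⁻¹) * amp x k +
        ∑ j, ((freeEnergy m k : ℂ) - E + omega m p)⁻¹ *
          ((freeEnergy m k : ℂ) - F + omega m p)⁻¹ * amp x (Function.update k j p))
          ∂momentumMeasure := by
    refine integral_congr_ae ?_
    filter_upwards [h2, ae_all_iff.2 h3] with p h6 h7
    rw [h6, freeEnergy_cons_sub, freeEnergy_cons_sub, Fin.sum_univ_succ, Fin.removeNth_zero,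
      Fin.tail_cons, Finset.sum_congr rfl fun j _ => h7 j, ← Finset.mul_sum]
    ring
  rw [h1, hval, integral_const_mul, ← mul_assoc, hs,
    integral_add (hI.mul_const _) (integrable_finsetSum _ fun j _ => h4 j), integral_mul_const,
    integral_finsetSum _ fun j _ => h4 j]
  ring

theorem potentialIntegrand_sub {E F : ℂ} (ψ : Fock n) (k : Fin n → ℝ × ℝ) (i : Fin n) {p : ℝ × ℝ}
    (hE : -m < ((freeEnergy m k : ℂ) - E).re) (hF : -m < ((freeEnergy m k : ℂ) - F).re)
    (hp : m ≤ omega m p) :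
    potentialIntegrand m E ψ k i p - potentialIntegrand m F ψ k i p =
      (E - F) * (((freeEnergy m k : ℂ) - E + omega m p)⁻¹ *
        ((freeEnergy m k : ℂ) - F + omega m p)⁻¹ * amp ψ (Function.update k i p)) := by
  have e1 := ne_zero_of_neg_lt_re hE hp
  have e2 := ne_zero_of_neg_lt_re hF hp
  simp only [potentialIntegrand]
  field_simp
  ring

/-- The principal operators at two energies have the same domain and differ by
`-(E - F) (1 + b a(E)⁻¹ a(F)⁻¹ b†)`. -/
theorem mem_graph_principalOp_of_mem (hm : 0 < m) (hmu : mu < m) {E F : ℂ}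
    (hE : E.re < n * m + m) (hF : F.re < n * m + m) {x y w : Fock n} {c : Fock (n + 1)}
    (hc : IsAInvBdag m lam n F x c) (hw : IsBAInv m lam n E c w)
    (h : (x, y) ∈ (principalOp m mu lam n F).graph) :
    (x, y - (E - F) • (x + w)) ∈ (principalOp m mu lam n E).graph := by
  obtain ⟨M, hM⟩ := exists_clm_diagonal (n := n) (lam := lam) hm hE hF
  obtain ⟨u, v, hu, hv, rfl⟩ := (mem_graph_sub _ _ _ _).1 h
  -- K changes by -(E - F)(1 + M) and U by (E - F)(w - M x), the exchange part; `M` cancels in K -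
  -- U.
  refine (mem_graph_sub _ _ _ _).2 ⟨u + (-(E - F)) • (x + M x), v + (E - F) • (w + (-1 : ℂ) • M x),
    ?_, ?_, by module⟩
  · rw [kineticOp, mem_graph_funH0] at hu ⊢
    filter_upwards [hu, hM x, amp_add u ((-(E - F)) • (x + M x)),
      amp_smul (-(E - F)) (x + M x), amp_add x (M x), ae_le_freeEnergy m n] with k a b d e f g
    rw [d, Pi.add_apply, e, Pi.smul_apply, f, Pi.add_apply, a, b,
      kineticSymbol_sub hm hmu (neg_lt_re hE g) (neg_lt_re hF g), smul_eq_mul]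
    ring
  · rw [mem_graph_potentialOp] at hv ⊢
    refine ⟨ae_integrable_potentialIntegrand hm hE x, ?_⟩
    filter_upwards [hv.2, hM x, amp_add v ((E - F) • (w + (-1 : ℂ) • M x)),
      amp_smul (E - F) (w + (-1 : ℂ) • M x), amp_add w ((-1 : ℂ) • M x), amp_smul (-1 : ℂ) (M x),
      ae_le_freeEnergy m n, ae_baInv_aInvBdag hm hE hF hc hw,
      ae_integrable_potentialIntegrand hm hE x, ae_integrable_potentialIntegrand hm hF x]
      with k a b d e f f' g h1 i1 i2
    have hsum : (∑ j, ∫ p, ((freeEnergy m k : ℂ) - E + omega m p)⁻¹ *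
        ((freeEnergy m k : ℂ) - F + omega m p)⁻¹ * amp x (Function.update k j p)
          ∂momentumMeasure) * (E - F) =
        ∑ j, ∫ p, potentialIntegrand m E x k j p ∂momentumMeasure -
        ∑ j, ∫ p, potentialIntegrand m F x k j p ∂momentumMeasure := by
      rw [Finset.sum_mul, ← Finset.sum_sub_distrib]
      refine Finset.sum_congr rfl fun j _ => ?_
      rw [← integral_sub (i1 j) (i2 j), ← integral_mul_const]
      refine integral_congr_ae ?_
      filter_upwards [ae_le_omega m] with p hp
      rw [potentialIntegrand_sub x k j (neg_lt_re hE g) (neg_lt_re hF g) hp]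
      ring
    rw [d, Pi.add_apply, e, Pi.smul_apply, f, Pi.add_apply, f', Pi.smul_apply, a, h1, b,
      smul_eq_mul, smul_eq_mul]
    linear_combination (lam : ℂ) ^ 2 * hsum

end

/-! ### The block resolvent -/

section

variable {m mu lam : ℝ} {n : ℕ}

/-- The operator with blocks `α = A + C Ψ B`, `β = -Ψ B`, `γ = -C Ψ`, `δ = Ψ`. -/
def blockOperator (A : Fock (n + 1) →L[ℂ] Fock (n + 1)) (B : Fock (n + 1) →L[ℂ] Fock n)
    (C : Fock n →L[ℂ] Fock (n + 1)) (Ψ : Fock n →L[ℂ] Fock n) : Sector n →L[ℂ] Sector n :=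
  let e := WithLp.prodContinuousLinearEquiv 2 ℂ (Fock (n + 1)) (Fock n)
  let f := ContinuousLinearMap.fst ℂ (Fock (n + 1)) (Fock n)
  -- Schur complement: eliminating the upper component of (H - E)(φ, v) = (f, g) gives Φ v = g - b
  -- a⁻¹ f and φ = a⁻¹ f - a⁻¹ b† v.
  let v := Ψ ∘L (ContinuousLinearMap.snd ℂ (Fock (n + 1)) (Fock n) - B ∘L f)
  (e.symm : Fock (n + 1) × Fock n →L[ℂ] Sector n) ∘L ((A ∘L f - C ∘L v).prod v) ∘L
    (e : Sector n →L[ℂ] Fock (n + 1) × Fock n)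

theorem blockOperator_apply (A : Fock (n + 1) →L[ℂ] Fock (n + 1))
    (B : Fock (n + 1) →L[ℂ] Fock n) (C : Fock n →L[ℂ] Fock (n + 1)) (Ψ : Fock n →L[ℂ] Fock n)
    (f : Fock (n + 1)) (g : Fock n) :
    blockOperator A B C Ψ (WithLp.toLp 2 (f, g)) =
      WithLp.toLp 2 (A f - C (Ψ (g - B f)), Ψ (g - B f)) :=
  rfl

/-- The resolvent identity for block operators. -/
theorem blockOperator_sub {A A₀ : Fock (n + 1) →L[ℂ] Fock (n + 1)}
    {B B₀ : Fock (n + 1) →L[ℂ] Fock n} {C C₀ : Fock n →L[ℂ] Fock (n + 1)}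
    {Ψ Ψ₀ : Fock n →L[ℂ] Fock n} {d : ℂ} (hA : ∀ f, A f - A₀ f = d • A (A₀ f))
    (hB : ∀ f, B f - B₀ f = d • B (A₀ f)) (hC : ∀ g, C g - C₀ g = d • A (C₀ g))
    (hΨ : ∀ g, Ψ g - Ψ₀ g = d • Ψ (Ψ₀ g + B (C₀ (Ψ₀ g)))) (x : Sector n) :
    blockOperator A B C Ψ x - blockOperator A₀ B₀ C₀ Ψ₀ x =
      d • blockOperator A B C Ψ (blockOperator A₀ B₀ C₀ Ψ₀ x) := by
  obtain ⟨f, g⟩ := x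
  simp only [blockOperator_apply]
  set v₀ := Ψ₀ (g - B₀ f) with hv₀
  set v := Ψ (g - B f) with hv
  -- This is the lower component of the identity; the upper one follows from it with `hA` and `hC`.
  have h1 : d • Ψ (v₀ - B (A₀ f - C₀ v₀)) = v - v₀ := by
    have h2 := hΨ (g - B₀ f)
    rw [← hv₀] at h2
    have h3 : v₀ - B (A₀ f - C₀ v₀) = (v₀ + B (C₀ v₀)) - B (A₀ f) := by
      rw [map_sub]; abel
    rw [h3, map_sub, smul_sub, ← h2, ← map_smul Ψ, ← hB, hv]
    simp only [map_sub]
    abel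
  rw [← WithLp.toLp_sub, ← WithLp.toLp_smul, Prod.smul_mk, h1, Prod.mk_sub_mk]
  congr 2
  rw [smul_sub, ← map_smul C, h1, map_sub A, smul_sub, ← hA, ← hC, map_sub C]
  abel

theorem blockOperator_injective {A : Fock (n + 1) →L[ℂ] Fock (n + 1)}
    {B : Fock (n + 1) →L[ℂ] Fock n} {C : Fock n →L[ℂ] Fock (n + 1)} {Ψ : Fock n →L[ℂ] Fock n}
    (hA : Function.Injective A) (hΨ : Function.Injective Ψ) :
    Function.Injective (blockOperator A B C Ψ) := by
  rintro ⟨f, g⟩ ⟨f', g'⟩ h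
  simp only [blockOperator_apply] at h
  have h' := WithLp.toLp_injective 2 h
  obtain ⟨h1, h2⟩ := Prod.mk.inj h'
  rw [h2, sub_left_inj] at h1
  have hf := hA h1
  subst hf
  have hg := sub_left_injective (hΨ h2)
  subst hg
  rfl

theorem blockOperator_symm {A : Fock (n + 1) →L[ℂ] Fock (n + 1)}
    {B : Fock (n + 1) →L[ℂ] Fock n} {C : Fock n →L[ℂ] Fock (n + 1)} {Ψ : Fock n →L[ℂ] Fock n}
    (hA : ∀ f f', inner ℂ (A f) f' = inner ℂ f (A f'))
    (hBC : ∀ f g, inner ℂ (B f) g = inner ℂ f (C g))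
    (hΨ : ∀ g g', inner ℂ (Ψ g) g' = inner ℂ g (Ψ g')) (x y : Sector n) :
    inner ℂ (blockOperator A B C Ψ x) y = inner ℂ x (blockOperator A B C Ψ y) := by
  obtain ⟨f, g⟩ := x
  obtain ⟨f', g'⟩ := y
  have hCB : ∀ g f, inner ℂ (C g) f = inner ℂ g (B f) := fun g f => by
    rw [← inner_conj_symm (𝕜 := ℂ) (C g) f, ← hBC]
    exact inner_conj_symm g (B f)
  simp only [blockOperator_apply, WithLp.prod_inner_apply]
  rw [inner_sub_left, inner_sub_right, hA, hCB, ← hBC]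
  have h := hΨ (g - B f) (g' - B f')
  rw [inner_sub_right, inner_sub_left] at h
  linear_combination h

theorem isBlockResolvent_iff {E : ℂ} {A : Fock (n + 1) →L[ℂ] Fock (n + 1)}
    {B : Fock (n + 1) →L[ℂ] Fock n} {C : Fock n →L[ℂ] Fock (n + 1)} {Ψ : Fock n →L[ℂ] Fock n}
    (hA : ∀ x y, (x, y) ∈ (funH0 m (n + 1) fun h => ((h : ℂ) - E)⁻¹).graph ↔ A x = y)
    (hB : ∀ f w, IsBAInv m lam n E f w ↔ B f = w)
    (hC : ∀ g u, IsAInvBdag m lam n E g u ↔ C g = u) (R : Sector n →L[ℂ] Sector n) :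
    IsBlockResolvent m lam n E Ψ R ↔ R = blockOperator A B C Ψ := by
  have hform : ∀ f g, WithLp.toLp 2 (A f + C (Ψ (B f)) - C (Ψ g), -Ψ (B f) + Ψ g) =
      blockOperator A B C Ψ (WithLp.toLp 2 (f, g)) := by
    intro f g
    rw [blockOperator_apply]
    congr 2
    · simp only [map_sub]; abel
    · simp only [map_sub]; abel
  constructor
  · intro h
    ext1 x
    obtain ⟨f, g⟩ := x
    obtain ⟨af, bf, cf, cg, h1, h2, h3, h4, h5⟩ := h f g
    rw [hA] at h1
    rw [hB] at h2
    rw [hC] at h3 h4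
    subst h1 h2 h3 h4
    rw [h5, hform]
  · rintro rfl f g
    exact ⟨A f, B f, C (Ψ (B f)), C (Ψ g), (hA _ _).2 rfl, (hB _ _).2 rfl, (hC _ _).2 rfl,
      (hC _ _).2 rfl, (hform f g).symm⟩

theorem ae_freeEnergy_sub_ne_zero {E : ℂ} (hE : E.re < n * m + m) :
    ∀ᵐ k ∂nMeasure (n + 1), (freeEnergy m k : ℂ) - E ≠ 0 := by
  filter_upwards [ae_le_freeEnergy m (n + 1)] with k hk h0
  have := congrArg Complex.re h0
  push_cast at hk
  simp only [Complex.sub_re, Complex.ofReal_re, Complex.zero_re] at this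
  linarith

/-- The block operators at two energies satisfy the resolvent identity. -/
theorem blockOperator_resolvent_identity (hm : 0 < m) (hmu : mu < m) {E F : ℂ}
    (hE : E.re < n * m + m) (hF : F.re < n * m + m)
    {A A₀ : Fock (n + 1) →L[ℂ] Fock (n + 1)} {B B₀ : Fock (n + 1) →L[ℂ] Fock n}
    {C C₀ : Fock n →L[ℂ] Fock (n + 1)} {Ψ Ψ₀ : Fock n →L[ℂ] Fock n}
    (hA : ∀ x y, (x, y) ∈ (funH0 m (n + 1) fun h => ((h : ℂ) - E)⁻¹).graph ↔ A x = y)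
    (hB : ∀ f w, IsBAInv m lam n E f w ↔ B f = w)
    (hC : ∀ g u, IsAInvBdag m lam n E g u ↔ C g = u)
    (hΨ : HasBoundedInverse (principalOp m mu lam n E) Ψ)
    (hA₀ : ∀ x y, (x, y) ∈ (funH0 m (n + 1) fun h => ((h : ℂ) - F)⁻¹).graph ↔ A₀ x = y)
    (hB₀ : ∀ f w, IsBAInv m lam n F f w ↔ B₀ f = w)
    (hC₀ : ∀ g u, IsAInvBdag m lam n F g u ↔ C₀ g = u)
    (hΨ₀ : HasBoundedInverse (principalOp m mu lam n F) Ψ₀) (x : Sector n) :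
    blockOperator A B C Ψ x - blockOperator A₀ B₀ C₀ Ψ₀ x =
      (E - F) • blockOperator A B C Ψ (blockOperator A₀ B₀ C₀ Ψ₀ x) := by
  have hAa : ∀ f, amp (A f) =ᵐ[nMeasure (n + 1)]
      fun k => ((freeEnergy m k : ℂ) - E)⁻¹ * amp f k := fun f =>
    (mem_graph_funH0 m (n + 1) (fun h => ((h : ℂ) - E)⁻¹) f (A f)).1 ((hA f _).2 rfl)
  have hA₀a : ∀ f, amp (A₀ f) =ᵐ[nMeasure (n + 1)]
      fun k => ((freeEnergy m k : ℂ) - F)⁻¹ * amp f k := fun f =>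
    (mem_graph_funH0 m (n + 1) (fun h => ((h : ℂ) - F)⁻¹) f (A₀ f)).1 ((hA₀ f _).2 rfl)
  refine blockOperator_sub (fun f => ?_) (fun f => ?_) (fun g => ?_) (fun g => ?_) x
  · rw [sub_eq_iff_eq_add]
    refine amp_ext ?_
    filter_upwards [hAa f, hA₀a f, hAa (A₀ f), amp_add ((E - F) • A (A₀ f)) (A₀ f),
      amp_smul (E - F) (A (A₀ f)), ae_freeEnergy_sub_ne_zero hE,
      ae_freeEnergy_sub_ne_zero hF] with k a b c d e h1 h2
    rw [d, Pi.add_apply, e, Pi.smul_apply, c, b, a, smul_eq_mul]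
    field_simp
    ring
  · rw [sub_eq_iff_eq_add]
    refine amp_ext ?_
    filter_upwards [((hB f _).2 rfl).2, ((hB₀ f _).2 rfl).2, ((hB (A₀ f) _).2 rfl).2,
      amp_add ((E - F) • B (A₀ f)) (B₀ f), amp_smul (E - F) (B (A₀ f)),
      ae_integrable_baInv hm hE f, ae_integrable_baInv hm hF f,
      ae_cons (P := fun k => amp (A₀ f) k = ((freeEnergy m k : ℂ) - F)⁻¹ * amp f k) (hA₀a f),
      ae_cons (P := fun k => (freeEnergy m k : ℂ) - E ≠ 0) (ae_freeEnergy_sub_ne_zero hE),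
      ae_cons (P := fun k => (freeEnergy m k : ℂ) - F ≠ 0) (ae_freeEnergy_sub_ne_zero hF)] with k a b c d e i1 i2 h0 h1 h2
    have hI : (∫ p : ℝ × ℝ, amp f (Fin.cons p k) /
          ((freeEnergy m (Fin.cons p k : Fin (n + 1) → ℝ × ℝ) : ℂ) - E) ∂momentumMeasure) -
        ∫ p : ℝ × ℝ, amp f (Fin.cons p k) /
          ((freeEnergy m (Fin.cons p k : Fin (n + 1) → ℝ × ℝ) : ℂ) - F) ∂momentumMeasure =
        (E - F) * ∫ p : ℝ × ℝ, amp (A₀ f) (Fin.cons p k) /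
          ((freeEnergy m (Fin.cons p k : Fin (n + 1) → ℝ × ℝ) : ℂ) - E) ∂momentumMeasure := by
      rw [← integral_sub i1 i2, ← integral_const_mul]
      refine integral_congr_ae ?_
      filter_upwards [h0, h1, h2] with p h3 h4 h5
      rw [h3]
      field_simp
      ring
    rw [d, Pi.add_apply, e, Pi.smul_apply, a, b, c, smul_eq_mul]
    linear_combination (lam : ℂ) * ((Real.sqrt (n + 1) : ℝ) : ℂ) * hI
  · rw [sub_eq_iff_eq_add]
    refine amp_ext ?_
    filter_upwards [(hC g _).2 rfl, (hC₀ g _).2 rfl, hAa (C₀ g),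
      amp_add ((E - F) • A (C₀ g)) (C₀ g), amp_smul (E - F) (A (C₀ g)),
      ae_freeEnergy_sub_ne_zero hE, ae_freeEnergy_sub_ne_zero hF] with k a b c d e h1 h2
    rw [d, Pi.add_apply, e, Pi.smul_apply, c, b, a, smul_eq_mul]
    field_simp
    ring
  -- Applying Ψ = Φ(E)⁻¹ to the formula for Φ(E) at the vector Ψ₀ g yields Ψ - Ψ₀ = (E - F) Ψ (1 + B
  -- C₀) Ψ₀.
  · have h1 := mem_graph_principalOp_of_mem hm hmu hE hF ((hC₀ (Ψ₀ g) _).2 rfl)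
      ((hB (C₀ (Ψ₀ g)) _).2 rfl) ((hΨ₀ (Ψ₀ g) g).2 rfl)
    rw [hΨ, map_sub, map_smul] at h1
    conv_lhs => rw [← h1]
    abel

/-! ### Nontriviality of the sectors -/

theorem momentumMeasure_univ_pos : 0 < momentumMeasure Set.univ := by
  rw [pos_iff_ne_zero, Ne, Measure.measure_univ_eq_zero, momentumMeasure, withDensity_eq_zero_iff
    (by fun_prop)]
  intro h
  have hs : MeasurableSet {k : ℝ × ℝ | 0 < k.1} :=
    measurableSet_lt (measurable_const (a := (0 : ℝ))) measurable_fst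
  rw [Filter.EventuallyEq, ae_restrict_iff' hs] at h
  have h0 : volume {k : ℝ × ℝ | 0 < k.1} = 0 := by
    refine measure_mono_null (t := {k | ¬ (k ∈ {k : ℝ × ℝ | 0 < k.1} →
      ENNReal.ofReal (1 / ((2 * Real.pi) ^ 2 * (2 * k.1))) = (0 : ℝ × ℝ → ENNReal) k)}) ?_ h
    intro k hk hk'
    have hk0 : 0 < k.1 := hk
    have h1 := hk' hk
    simp only [Pi.zero_apply, ENNReal.ofReal_eq_zero] at h1
    have : 0 < 1 / ((2 * Real.pi) ^ 2 * (2 * k.1)) := by positivity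
    linarith
  have hopen : IsOpen {k : ℝ × ℝ | 0 < k.1} := isOpen_lt continuous_const continuous_fst
  exact (hopen.measure_pos volume ⟨(1, 0), by simp⟩).ne' h0

/-- Needed because an operator on the zero space has empty spectrum. The indicator of a cube tⁿ,
with t of finite positive measure, is a nonzero symmetric state. -/
instance nontrivial_fock (n : ℕ) : Nontrivial (Fock n) := by
  obtain ⟨t, ht, -, ht0, htt⟩ :=
    Measure.exists_subset_measure_lt_top MeasurableSet.univ momentumMeasure_univ_pos
  let s : Set (Fin n → ℝ × ℝ) := Set.univ.pi fun _ => t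
  have hs : MeasurableSet s := MeasurableSet.univ_pi fun _ => ht
  have hμ : nMeasure n s = momentumMeasure t ^ n := by
    rw [nMeasure, Measure.pi_pi]
    simp
  have hμtop : nMeasure n s ≠ ⊤ := by
    rw [hμ]
    exact (ENNReal.pow_lt_top htt).ne
  obtain ⟨χ, hχ⟩ := exists_amp_eq (f := s.indicator fun _ => (1 : ℂ))
    (memLp_indicator_const 2 hs 1 (Or.inr hμtop)) fun σ => ae_of_all _ fun k => by
      have : k ∘ σ ∈ s ↔ k ∈ s := by
        simp only [s, Set.mem_pi, Set.mem_univ, forall_true_left, Function.comp_apply]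
        exact σ.forall_congr_left.trans (by simp)
      by_cases hk : k ∈ s
      · simp [hk, this.2 hk]
      · simp [hk, mt this.1 hk]
  refine ⟨χ, 0, ?_⟩
  rintro rfl
  have h1 : s.indicator (fun _ => (1 : ℂ)) =ᵐ[nMeasure n] 0 := hχ.symm.trans (amp_zero n)
  rw [Set.indicator_ae_eq_zero] at h1
  have h2 : nMeasure n s = 0 := by
    simpa [Function.support_const] using h1
  rw [hμ] at h2
  exact ht0.ne' (eq_zero_of_pow_eq_zero h2)

end

/-! ### The Hamiltonian -/

section

variable {m mu lam : ℝ} {n : ℕ}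

theorem coupling_ratio_lt_one {E : ℝ}
    (hE : E < m * ((n : ℝ) - 1) + mu - lam ^ 2 * Real.pi * n / 2) :
    E < m * ((n : ℝ) - 1) + mu ∧
      lam ^ 2 * Real.pi * n / (2 * (m * ((n : ℝ) - 1) + mu - E)) < 1 := by
  have h0 : 0 ≤ lam ^ 2 * Real.pi * n / 2 := by positivity
  refine ⟨by linarith, ?_⟩
  rw [div_lt_one (by linarith)]
  linarith

theorem re_lt_of_lt_threshold (hmu : mu < m) {E : ℂ} (hE : E.re < n * m + mu) :
    E.re < n * m + m := by
  linarith

theorem clm_aInv_injective {E : ℂ} (hE : E.re < n * m + m)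
    {A : Fock (n + 1) →L[ℂ] Fock (n + 1)}
    (hA : ∀ x y, (x, y) ∈ (funH0 m (n + 1) fun h => ((h : ℂ) - E)⁻¹).graph ↔ A x = y) :
    Function.Injective A := by
  rw [injective_iff_map_eq_zero]
  intro f hf
  have h := (mem_graph_funH0 m (n + 1) (fun h => ((h : ℂ) - E)⁻¹) f 0).1 ((hA f 0).2 hf)
  refine amp_ext ?_
  filter_upwards [h, amp_zero (n + 1), ae_freeEnergy_sub_ne_zero hE] with k a b c
  rw [b, Pi.zero_apply, eq_comm, mul_eq_zero] at a
  rw [b, Pi.zero_apply]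
  exact a.resolve_left (inv_ne_zero c)

theorem clm_aInv_symm {E : ℝ} {A : Fock (n + 1) →L[ℂ] Fock (n + 1)}
    (hA : ∀ x y, (x, y) ∈ (funH0 m (n + 1) fun h => ((h : ℂ) - (E : ℂ))⁻¹).graph ↔ A x = y)
    (f g : Fock (n + 1)) : inner ℂ (A f) g = inner ℂ f (A g) := by
  have hAa : ∀ f, amp (A f) =ᵐ[nMeasure (n + 1)]
      fun k => ((freeEnergy m k : ℂ) - E)⁻¹ * amp f k := fun f =>
    (mem_graph_funH0 m (n + 1) (fun h => ((h : ℂ) - E)⁻¹) f (A f)).1 ((hA f _).2 rfl)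
  rw [inner_eq_integral, inner_eq_integral]
  refine integral_congr_ae ?_
  filter_upwards [hAa f, hAa g] with k a b
  rw [a, b, map_mul, map_inv₀, map_sub, Complex.conj_ofReal, Complex.conj_ofReal]
  ring

theorem HasBoundedInverse.injective {V : Type*} [NormedAddCommGroup V] [NormedSpace ℂ V]
    {A : V →ₗ.[ℂ] V} {T : V →L[ℂ] V} (h : HasBoundedInverse A T) : Function.Injective T := by
  rw [injective_iff_map_eq_zero]
  intro y hy
  exact LinearPMap.graph_fst_eq_zero_snd A ((h 0 y).2 hy) rfl

/-- H is built from its block resolvent at one energy E₀ below the asserted bound. There Φ(E₀)⁻¹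
exists and is symmetric, and the same energy tests uniqueness and nonemptiness of the spectrum. -/
theorem exists_hamiltonian (hm : 0 < m) (hmu : mu < m) :
    ∃ H : Sector n →ₗ.[ℂ] Sector n, IsHamiltonian m mu lam n H ∧
      (∀ H', IsHamiltonian m mu lam n H' → H' = H) ∧ (realSpectrum H).Nonempty := by
  obtain ⟨E₀, hE₀⟩ : ∃ E₀ : ℝ, E₀ < m * ((n : ℝ) - 1) + mu - lam ^ 2 * Real.pi * n / 2 :=
    exists_lt _
  obtain ⟨hlt, hratio⟩ := coupling_ratio_lt_one hE₀
  have hthr : (E₀ : ℂ).re < n * m + mu := by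
    rw [Complex.ofReal_re]
    linarith
  have hthr' := re_lt_of_lt_threshold hmu hthr
  obtain ⟨-, Ψ₀, hΨ₀, hΨsymm⟩ := exists_principal_inverse (n := n) hm hmu hlt hratio
  obtain ⟨A₀, hA₀⟩ := exists_clm_aInv hthr'
  obtain ⟨B₀, hB₀⟩ := exists_clm_baInv (lam := lam) hm hthr'
  obtain ⟨C₀, hC₀⟩ := exists_clm_aInvBdag (lam := lam) hm hthr'
  set R₀ := blockOperator A₀ B₀ C₀ Ψ₀ with hR₀
  have hinj : Function.Injective R₀ :=
    blockOperator_injective (clm_aInv_injective hthr' hA₀) hΨ₀.injective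
  have hsymm : ∀ x y, inner ℂ (R₀ x) y = inner ℂ x (R₀ y) :=
    blockOperator_symm (clm_aInv_symm hA₀)
      (fun f g => inner_baInv_eq hm hthr' ((hB₀ f _).2 rfl) ((hC₀ g _).2 rfl)) hΨsymm
  have hres := hasBoundedInverse_ofResolvent hinj (E₀ : ℂ)
  refine ⟨ofResolvent R₀ (E₀ : ℂ), ⟨isSelfAdjoint_ofResolvent hinj hsymm E₀, ?_⟩, ?_,
    realSpectrum_nonempty hinj hsymm hres⟩
  · intro E hE Ψ hΨ
    have hE' := re_lt_of_lt_threshold hmu hE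
    obtain ⟨A, hA⟩ := exists_clm_aInv hE'
    obtain ⟨B, hB⟩ := exists_clm_baInv (lam := lam) hm hE'
    obtain ⟨C, hC⟩ := exists_clm_aInvBdag (lam := lam) hm hE'
    refine ⟨blockOperator A B C Ψ, (isBlockResolvent_iff hA hB hC _).2 rfl,
      hasBoundedInverse_of_resolvent_identity hres
        (blockOperator_resolvent_identity hm hmu hE' hthr' hA hB hC hΨ hA₀ hB₀ hC₀ hΨ₀)
        fun x => ?_⟩
    -- The identity with the two energies exchanged supplies the product in the opposite order.
    have h := blockOperator_resolvent_identity hm hmu hthr' hE' hA₀ hB₀ hC₀ hΨ₀ hA hB hC hΨ x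
    rw [← neg_sub, h, ← neg_smul, neg_sub]
  · intro H' hH'
    obtain ⟨R, hR, hR'⟩ := hH'.resolvent E₀ hthr Ψ₀ hΨ₀
    rw [(isBlockResolvent_iff hA₀ hB₀ hC₀ R).1 hR] at hR'
    exact eq_of_resolvent hR' hres

/-- Below the bound the coupling ratio is less than 1, so Φ(E) is invertible and the block formula
puts E in the resolvent set. -/
theorem le_of_mem_realSpectrum (hm : 0 < m) (hmu : mu < m) {H : Sector n →ₗ.[ℂ] Sector n}
    (hH : IsHamiltonian m mu lam n H) {E : ℝ} (hE : E ∈ realSpectrum H) :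
    m * ((n : ℝ) - 1) + mu - lam ^ 2 * Real.pi * n / 2 ≤ E := by
  by_contra hlt
  obtain ⟨h1, h2⟩ := coupling_ratio_lt_one (not_le.1 hlt)
  obtain ⟨-, Ψ, hΨ, -⟩ := exists_principal_inverse (n := n) hm hmu h1 h2
  obtain ⟨R, -, hR⟩ := hH.resolvent E (by rw [Complex.ofReal_re]; linarith) Ψ hΨ
  exact hE ⟨R, hR⟩

end

end LightFrontLee

end

/-! ### The theorem -/

theorem mainTheorem5 (m mu lam : ℝ) (hm : 0 < m) (hmu : mu < m) (n : ℕ) :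
    (∀ E : ℝ, E < m * ((n : ℝ) - 1) + mu →
      lam ^ 2 * Real.pi * n / (2 * (m * ((n : ℝ) - 1) + mu - E)) < 1 →
        (∃ T : LightFrontLee.Fock n →L[ℂ] LightFrontLee.Fock n,
          LightFrontLee.relativePotential m mu lam n E =
            (T : LightFrontLee.Fock n →ₗ[ℂ] LightFrontLee.Fock n).toPMap ⊤ ∧ ‖T‖ < 1) ∧
        (∃ Φinv : LightFrontLee.Fock n →L[ℂ] LightFrontLee.Fock n,
          LightFrontLee.HasBoundedInverse
            (LightFrontLee.principalOp m mu lam n E) Φinv)) ∧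
    ∃ H : LightFrontLee.Sector n →ₗ.[ℂ] LightFrontLee.Sector n,
      LightFrontLee.IsHamiltonian m mu lam n H ∧
      (∀ H' : LightFrontLee.Sector n →ₗ.[ℂ] LightFrontLee.Sector n,
        LightFrontLee.IsHamiltonian m mu lam n H' → H' = H) ∧
      (LightFrontLee.realSpectrum H).Nonempty ∧
      BddBelow (LightFrontLee.realSpectrum H) ∧
      m * ((n : ℝ) - 1) + mu - lam ^ 2 * Real.pi * n / 2 ≤
        LightFrontLee.groundStateEnergy H := by
  refine ⟨fun E hE hlt => ?_, ?_⟩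
  · obtain ⟨hT, Φinv, hΦ, -⟩ := LightFrontLee.exists_principal_inverse (n := n) hm hmu hE hlt
    exact ⟨hT, Φinv, hΦ⟩
  · obtain ⟨H, hH, huniq, hne⟩ := LightFrontLee.exists_hamiltonian (lam := lam) (n := n) hm hmu
    have hbound := fun E (hE : E ∈ LightFrontLee.realSpectrum H) =>
      LightFrontLee.le_of_mem_realSpectrum hm hmu hH hE
    exact ⟨H, hH, huniq, hne, ⟨_, hbound⟩, le_csInf hne hbound⟩
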